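/- Let $\sigma_x=\begin{pmatrix}0&1\\1&0\end{pmatrix}$ and $\sigma_z=\begin{pmatrix}1&0\\0&-1\end{pmatrix}$ be Pauli matrices, and define the two-qubit unitary $G:=\exp(\mathrm{i}H)$ on $\mathbb C^2\otimes\mathbb C^2$, where \[ H:=\sigma_x\otimes \mathbf 1+\mathbf 1\otimes\sigma_z+\sigma_x\otimes\sigma_x+\sigma_z\otimes\sigma_z . \] For $l\ge 3$ and $k\in\{0,\dots,l-1\}$ let $G_{k,\,k+1 \bmod l}$ denote the operator on $(\mathbb C^2)^{\otimes l}$ that acts as $G$ on the qubits $k$ and $k+1 \bmod l$ (in this order) and as the identity on all other qubits. Then, for every $l\ge 3$, the operators $G_{k,\,k+1 \bmod l}$, $k=0,\dots,l-1$, belong to $\mathrm{SU}(2^l)$, and the subgroup of $\mathrm{SU}(2^l)$ that they generate is dense in $\mathrm{SU}(2^l)$. -/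

import Mathlib

open scoped Kronecker

/-- The Pauli matrix `σ_x`. -/
def pauliX : Matrix (Fin 2) (Fin 2) ℂ := !![0, 1; 1, 0]

/-- The Pauli matrix `σ_z`. -/
def pauliZ : Matrix (Fin 2) (Fin 2) ℂ := !![1, 0; 0, -1]

/-- The two-qubit Hamiltonian `H = σ_x ⊗ 1 + 1 ⊗ σ_z + σ_x ⊗ σ_x + σ_z ⊗ σ_z`, as a matrix in the
computational basis, whose vectors are labelled by pairs of bits. -/
def hamiltonianH : Matrix (Fin 2 × Fin 2) (Fin 2 × Fin 2) ℂ :=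
  pauliX ⊗ₖ (1 : Matrix (Fin 2) (Fin 2) ℂ) + (1 : Matrix (Fin 2) (Fin 2) ℂ) ⊗ₖ pauliZ
    + pauliX ⊗ₖ pauliX + pauliZ ⊗ₖ pauliZ

/-- The two-qubit gate `G = exp(i H)` (matrix exponential). -/
noncomputable def gateG : Matrix (Fin 2 × Fin 2) (Fin 2 × Fin 2) ℂ :=
  NormedSpace.exp (Complex.I • hamiltonianH)

/-- The operator on `l` qubits which acts as the two-qubit operator `A` on the qubits `a` and `b`
(`a` carries the first tensor factor of `A` and `b` the second one; only used for `a ≠ b`) and as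
the identity on all the other qubits. The computational basis of `(ℂ²)^{⊗ l}` is labelled by the
bit strings `Fin l → Fin 2`. -/
def actOn {l : ℕ} (A : Matrix (Fin 2 × Fin 2) (Fin 2 × Fin 2) ℂ) (a b : Fin l) :
    Matrix (Fin l → Fin 2) (Fin l → Fin 2) ℂ :=
  Matrix.of fun x y => if ∀ j, j ≠ a → j ≠ b → x j = y j then A (x a, x b) (y a, y b) else 0

/-- The cyclic successor `k + 1 mod l` of a site `k` of the ring of `l` sites. -/
def cyclicSucc {l : ℕ} (k : Fin l) : Fin l :=
  ⟨((k : ℕ) + 1) % l, Nat.mod_lt _ k.pos⟩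

/-- The gate `G_{k, k+1 mod l}`: the gate `G` on the cyclically adjacent qubits `k`, `k + 1 mod l`
of a ring of `l` qubits. -/
noncomputable def ringGate (l : ℕ) (k : Fin l) : Matrix (Fin l → Fin 2) (Fin l → Fin 2) ℂ :=
  actOn gateG k (cyclicSucc k)

/-! The closure of the generated group is a closed, bounded monoid of unitary matrices. The `X` with
`exp (tX)` in it for all real `t` form a real Lie algebra: sums come from the Lie product formula,
commutators from differentiating a conjugation. If its complexification contains all traceless
matrices, then the closure contains SU, because every special unitary matrix is `exp (iA)` with `A`
Hermitian and traceless (`specialUnitaryGroup_le_of_single_mem`).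

The Hamiltonians enter this Lie algebra for an arithmetic reason. Since `H³ = 8H`, the eigenvalues
of `H` lie in `{0, ±2√2}` and `t ↦ exp (itH)` has period `π/√2`. This period is irrational because
`π²` is, so the integers are dense modulo it and the powers of one gate are dense in the whole
one-parameter group (`exp_smul_mem_closure`).

The rest is Lie algebra. Two adjacent Hamiltonians on three distinct sites, available as `l ≥ 3`,
generate `σ_x σ_z` at the middle site (`y_mem_of_chain`). This operator splits each Hamiltonian into
Pauli terms, giving all one-site Pauli operators and all `σ_z σ_z` couplings. Their commutators
yield the matrix units that flip one bit, hence all off-diagonal matrix units, hence all traceless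
matrices. -/

/-! ### Irrationality of `π²` and of `π/√2` -/

section PiSquared

open intervalIntegral MeasureTheory.MeasureSpace Set Real Filter
open scoped Nat

/-- The integrals `∫ (1 - x²)ⁿ cos (π x / 2)` of Cartwright's proof of the irrationality of `π`. -/
noncomputable def cartwrightIntegral (n : ℕ) : ℝ :=
  ∫ x in (-1)..1, (1 - x ^ 2) ^ n * cos (x * (π / 2))

theorem cartwrightIntegral_zero : cartwrightIntegral 0 * (π / 2) = 2 := by
  rw [mul_comm, cartwrightIntegral]
  simp
  field_simp
  norm_num

/-- Two integrations by parts. Only the square of `π / 2` appears, which is why the method reaches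
`π²` and not just `π`. -/
theorem cartwrightIntegral_succ (n : ℕ) :
    cartwrightIntegral (n + 1) * (π / 2) ^ 2 =
      2 * (n + 1) * (2 * n + 1) * cartwrightIntegral n
        - 4 * (n + 1) * n * cartwrightIntegral (n - 1) := by
  rw [cartwrightIntegral]
  set θ : ℝ := π / 2 with hθ
  have hcos : cos θ = 0 := cos_pi_div_two
  let f (x : ℝ) : ℝ := 1 - x ^ 2
  let u₁ (x : ℝ) : ℝ := f x ^ (n + 1)
  let u₁' (x : ℝ) : ℝ := - (2 * (n + 1) * x * f x ^ n)
  let v₁ (x : ℝ) : ℝ := sin (x * θ)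
  let v₁' (x : ℝ) : ℝ := cos (x * θ) * θ
  let u₂ (x : ℝ) : ℝ := x * (f x) ^ n
  let u₂' (x : ℝ) : ℝ := (f x) ^ n - 2 * n * x ^ 2 * (f x) ^ (n - 1)
  let v₂ (x : ℝ) : ℝ := cos (x * θ)
  let v₂' (x : ℝ) : ℝ := -sin (x * θ) * θ
  have hfd : Continuous f := by fun_prop
  have hu₁d : Continuous u₁' := by fun_prop
  have hv₁d : Continuous v₁' := by fun_prop
  have hu₂d : Continuous u₂' := by fun_prop
  have hv₂d : Continuous v₂' := by fun_prop
  have hu₁_eval_one : u₁ 1 = 0 := by simp only [u₁, f]; simp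
  have hu₁_eval_neg_one : u₁ (-1) = 0 := by simp only [u₁, f]; simp
  have t : u₂ 1 * v₂ 1 - u₂ (-1) * v₂ (-1) = 0 := by simp [u₂, v₂, f, hcos]
  have hf (x) : HasDerivAt f (- 2 * x) x := by
    convert! (hasDerivAt_pow 2 x).const_sub 1 using 1
    simp
  have hu₁ (x) : HasDerivAt u₁ (u₁' x) x := by
    convert! (hf x).pow _ using 1
    simp only [Nat.add_succ_sub_one, u₁', Nat.cast_add_one]
    ring
  have hv₁ (x) : HasDerivAt v₁ (v₁' x) x := (hasDerivAt_mul_const θ).sin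
  have hu₂ (x) : HasDerivAt u₂ (u₂' x) x := by
    convert! (hasDerivAt_id' x).fun_mul ((hf x).fun_pow _) using 1
    simp only [u₂']
    ring
  have hv₂ (x) : HasDerivAt v₂ (v₂' x) x := (hasDerivAt_mul_const θ).cos
  convert_to (∫ (x : ℝ) in (-1)..1, u₁ x * v₁' x) * θ = _ using 1
  · simp_rw [u₁, v₁', f, ← intervalIntegral.integral_mul_const, sq θ, mul_assoc]
  rw [integral_mul_deriv_eq_deriv_mul (fun x _ => hu₁ x) (fun x _ => hv₁ x)
    (hu₁d.intervalIntegrable _ _) (hv₁d.intervalIntegrable _ _), hu₁_eval_one, hu₁_eval_neg_one,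
    zero_mul, zero_mul, sub_zero, zero_sub, ← integral_neg, ← integral_mul_const]
  convert_to ((-2 : ℝ) * (n + 1)) * ∫ (x : ℝ) in (-1)..1, (u₂ x * v₂' x) = _ using 1
  · rw [← integral_const_mul]
    congr 1 with x
    dsimp [u₁', v₁, u₂, v₂']
    ring
  rw [integral_mul_deriv_eq_deriv_mul (fun x _ => hu₂ x) (fun x _ => hv₂ x)
    (hu₂d.intervalIntegrable _ _) (hv₂d.intervalIntegrable _ _),
    mul_sub, t]
  -- Substituting `x² = 1 - f x` leaves two consecutive powers of `f`. At `n = 0` the truncated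
  -- exponent `n - 1` is harmless, as its coefficient vanishes.
  have (x : _) : u₂' x = (2 * n + 1) * f x ^ n - 2 * n * f x ^ (n - 1) := by
    cases n with
    | zero => simp [u₂']
    | succ n => ring!
  simp_rw [this, sub_mul, mul_assoc _ _ (v₂ _)]
  have : Continuous v₂ := by fun_prop
  rw [integral_sub, integral_const_mul, integral_const_mul]
  · change _ = 2 * (n + 1) * (2 * n + 1) * (∫ x in (-1)..1, f x ^ n * v₂ x)
        - 4 * (n + 1) * n * (∫ x in (-1)..1, f x ^ (n - 1) * v₂ x)
    ring
  all_goals exact Continuous.intervalIntegrable (by fun_prop) _ _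

theorem cartwrightIntegral_pos (n : ℕ) : 0 < cartwrightIntegral n := by
  refine integral_pos (by simp) (by fun_prop) ?_ ⟨0, by simp⟩
  refine fun x hx => mul_nonneg (pow_nonneg ?_ _) ?_
  · rw [sub_nonneg, sq_le_one_iff_abs_le_one, abs_le]
    exact ⟨hx.1.le, hx.2⟩
  refine cos_nonneg_of_neg_pi_div_two_le_of_le ?_ ?_ <;>
  nlinarith [hx.1, hx.2, pi_pos]

theorem cartwrightIntegral_le_two (n : ℕ) : cartwrightIntegral n ≤ 2 := by
  rw [← norm_of_nonneg (cartwrightIntegral_pos n).le]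
  refine (norm_integral_le_of_norm_le_const ?_).trans (show (1 : ℝ) * _ ≤ _ by norm_num)
  intro x hx
  simp only [uIoc_of_le, neg_le_self_iff, zero_le_one, mem_Ioc] at hx
  rw [norm_eq_abs, abs_mul, abs_pow]
  refine mul_le_one₀ (pow_le_one₀ (abs_nonneg _) ?_) (abs_nonneg _) (abs_cos_le_one _)
  rw [abs_le]
  constructor <;> nlinarith

/-- If `(π / 2)² = a / b`, then `bⁿ (π / 2)²ⁿ⁺¹ / n!` times the `n`-th integral is an integer. -/
theorem exists_int_eq_cartwrightIntegral {a b : ℤ} (h : (π / 2) ^ 2 * b = a) (n : ℕ) :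
    ∃ z : ℤ, cartwrightIntegral n * (π / 2) ^ (2 * n + 1) * (b : ℝ) ^ n = n ! * z := by
  induction n using Nat.twoStepInduction with
  | zero => exact ⟨2, by simp [cartwrightIntegral_zero]⟩
  | one =>
    refine ⟨4 * b, ?_⟩
    have h1 := cartwrightIntegral_succ 0
    simp only [CharP.cast_eq_zero, zero_add] at h1
    have h0 := cartwrightIntegral_zero
    push_cast
    simp only [Nat.factorial_one, Nat.cast_one]
    linear_combination (π / 2) * b * h1 + 2 * b * h0
  | more n ih1 ih2 =>
    obtain ⟨z1, hz1⟩ := ih1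
    obtain ⟨z2, hz2⟩ := ih2
    refine ⟨2 * (2 * n + 3) * b * z2 - 4 * a * b * z1, ?_⟩
    have h1 := cartwrightIntegral_succ (n + 1)
    simp only [Nat.add_sub_cancel] at h1
    have hf2 : ((n + 2)! : ℝ) = (n + 2) * (n + 1)! := by
      rw [Nat.factorial_succ]; push_cast; ring
    have hf1 : ((n + 1)! : ℝ) = (n + 1) * n ! := by
      rw [Nat.factorial_succ]; push_cast; ring
    push_cast at h1 ⊢
    rw [hf2]
    have e2 : cartwrightIntegral (n + 1) * (π / 2) ^ (2 * n + 3) * (b : ℝ) ^ (n + 1)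
        = (n + 1)! * z2 := by rw [← hz2]; ring_nf
    calc cartwrightIntegral (n + 2) * (π / 2) ^ (2 * (n + 2) + 1) * (b : ℝ) ^ (n + 2)
        = (cartwrightIntegral (n + 1 + 1) * (π / 2) ^ 2) * (π / 2) ^ (2 * n + 3) * b ^ (n + 2) := by
          ring_nf
      _ = 2 * (n + 2) * (2 * n + 3) * b *
            (cartwrightIntegral (n + 1) * (π / 2) ^ (2 * n + 3) * (b : ℝ) ^ (n + 1))
          - 4 * (n + 2) * (n + 1) * b * ((π / 2) ^ 2 * b) *
            (cartwrightIntegral n * (π / 2) ^ (2 * n + 1) * (b : ℝ) ^ n) := by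
          rw [h1]; ring
      _ = _ := by rw [e2, hz1, h, hf1]; ring

theorem irrational_pi_sq : Irrational (π ^ 2) := by
  rw [Irrational]
  rintro ⟨q, hq⟩
  have h : (π / 2) ^ 2 * ((4 * q.den : ℤ) : ℝ) = (q.num : ℤ) := by
    rw [div_pow, ← hq]
    have : (q : ℝ) * q.den = q.num := by exact_mod_cast Rat.mul_den_eq_num q
    push_cast
    linear_combination this
  set b : ℤ := 4 * q.den
  have lim : Tendsto (fun n : ℕ => 2 * (π / 2) * (((π / 2) ^ 2 * b) ^ n / n !)) atTop (nhds 0) := by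
    simpa using (FloorSemiring.tendsto_pow_div_factorial_atTop ((π / 2) ^ 2 * (b : ℝ))).const_mul
      (2 * (π / 2))
  obtain ⟨n, hn⟩ := (lim.eventually_lt_const one_pos).exists
  obtain ⟨z, hz⟩ := exists_int_eq_cartwrightIntegral h n
  have hfac : (0 : ℝ) < n ! := by positivity
  -- The integer `z` is positive, yet bounded by a quantity that the factorial drives below 1.
  have hz' : (z : ℝ) = cartwrightIntegral n * ((π / 2) * (((π / 2) ^ 2 * b) ^ n / n !)) := by
    apply mul_left_cancel₀ hfac.ne'
    rw [← hz, mul_pow, ← pow_mul, pow_succ]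
    field_simp
  have hc : 0 < (π / 2) * (((π / 2) ^ 2 * (b : ℝ)) ^ n / n !) := by
    have := pi_pos
    positivity
  have h0 : (0 : ℝ) < z := by
    rw [hz']
    exact mul_pos (cartwrightIntegral_pos n) hc
  have h1 : (z : ℝ) < 1 := by
    rw [hz']
    refine (mul_le_mul_of_nonneg_right (cartwrightIntegral_le_two n) hc.le).trans_lt ?_
    rwa [← mul_assoc]
  norm_cast at h0 h1
  lia

theorem irrational_pi_div_sqrt_two : Irrational (π / √2) := by
  intro ⟨q, hq⟩
  refine irrational_pi_sq ⟨2 * q ^ 2, ?_⟩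
  push_cast
  rw [hq, div_pow, sq_sqrt zero_le_two]
  ring

end PiSquared

/-! ### The Lie algebra of a closed bounded monoid -/

section TangentSpace

open NormedSpace Filter Topology

variable {𝔸 : Type*} [NormedRing 𝔸]

theorem pow_sub_pow_eq_sum {R : Type*} [Ring R] (A B : R) (n : ℕ) :
    A ^ n - B ^ n = ∑ j ∈ Finset.range n, A ^ j * (A - B) * B ^ (n - 1 - j) := by
  have h := Finset.sum_range_sub (fun j => A ^ j * B ^ (n - j)) n
  simp only [Nat.sub_self, pow_zero, mul_one, Nat.sub_zero, one_mul] at h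
  rw [← h]
  refine Finset.sum_congr rfl fun j hj => ?_
  have hj := Finset.mem_range.1 hj
  obtain ⟨m, rfl⟩ := Nat.exists_eq_add_of_lt hj
  rw [show j + m + 1 - (j + 1) = m by lia, show j + m + 1 - j = m + 1 by lia,
    show j + m + 1 - 1 - j = m by lia, pow_succ, pow_succ']
  noncomm_ring

/-- Telescoping turns an error in one factor into an error in the `n`-th power that grows only
linearly in `n`, provided the powers stay bounded. -/
theorem norm_pow_sub_pow_le {A B : 𝔸} {C D : ℝ} (n : ℕ) (hA : ∀ j, ‖A ^ j‖ ≤ C)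
    (hB : ∀ j ≤ n, ‖B ^ j‖ ≤ D) : ‖A ^ n - B ^ n‖ ≤ C * (n * ‖A - B‖) * D := by
  have hC : 0 ≤ C := (norm_nonneg _).trans (hA 0)
  rw [pow_sub_pow_eq_sum]
  refine (norm_sum_le_of_le (f := fun j => A ^ j * (A - B) * B ^ (n - 1 - j))
    (n := fun _ => C * ‖A - B‖ * D) _ fun j hj => ?_).trans (le_of_eq ?_)
  · refine (norm_mul_le _ _).trans (mul_le_mul ((norm_mul_le _ _).trans ?_) (hB _ (by lia))
      (norm_nonneg _) (by positivity))
    exact mul_le_mul_of_nonneg_right (hA j) (norm_nonneg _)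
  · simp
    ring

variable [NormedAlgebra ℂ 𝔸] [CompleteSpace 𝔸]

/-- The two curves agree to first order at 0, so at `t = 1/n` their difference is `o(1/n)`, which
beats the factor `n` from telescoping. -/
theorem hasDerivAt_exp_mul_exp_sub_exp (X Y : 𝔸) :
    HasDerivAt (fun t : ℝ => exp (t • X) * exp (t • Y) - exp (t • (X + Y))) 0 0 := by
  have h := ((hasDerivAt_exp_smul_const (𝕂 := ℝ) X 0).mul
    (hasDerivAt_exp_smul_const (𝕂 := ℝ) Y 0)).sub (hasDerivAt_exp_smul_const (𝕂 := ℝ) (X + Y) 0)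
  simp only [zero_smul, exp_zero, one_mul, mul_one, sub_self] at h
  exact h

/-- The Lie product formula, for one-parameter groups whose products stay bounded. -/
theorem tendsto_exp_mul_exp_pow (X Y : 𝔸) {C : ℝ}
    (hC : ∀ (s : ℝ) (j : ℕ), ‖(exp (s • X) * exp (s • Y)) ^ j‖ ≤ C) :
    Tendsto (fun n : ℕ => (exp ((n : ℝ)⁻¹ • X) * exp ((n : ℝ)⁻¹ • Y)) ^ n) atTop
      (𝓝 (exp (X + Y))) := by
  let _ : NormedAlgebra ℚ 𝔸 := NormedAlgebra.restrictScalars ℚ ℂ 𝔸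
  have hcont : Continuous fun t : ℝ => exp (t • (X + Y)) :=
    (exp_continuous (𝔸 := 𝔸)).comp (by fun_prop)
  obtain ⟨D, hD⟩ := (isCompact_Icc (a := (0 : ℝ)) (b := 1)).exists_bound_of_continuousOn
    hcont.continuousOn
  have hpow (n j : ℕ) : exp ((n : ℝ)⁻¹ • (X + Y)) ^ j = exp (((j : ℝ) * (n : ℝ)⁻¹) • (X + Y)) := by
    rw [← exp_nsmul, mul_smul, Nat.cast_smul_eq_nsmul]
  have hlim : Tendsto (fun n : ℕ => (n : ℝ) * ‖exp ((n : ℝ)⁻¹ • X) * exp ((n : ℝ)⁻¹ • Y)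
      - exp ((n : ℝ)⁻¹ • (X + Y))‖) atTop (𝓝 0) := by
    have h := (hasDerivAt_iff_tendsto_slope_zero.1 (hasDerivAt_exp_mul_exp_sub_exp X Y)).norm
    have hn : Tendsto (fun n : ℕ => (n : ℝ)⁻¹) atTop (𝓝[≠] 0) := by
      refine tendsto_nhdsWithin_iff.2 ⟨tendsto_inv_atTop_nhds_zero_nat, ?_⟩
      filter_upwards [eventually_gt_atTop 0] with n hn
      simp [hn.ne']
    have h2 := h.comp hn
    simp only [norm_zero] at h2
    refine h2.congr fun n => ?_
    simp [norm_smul]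
  have hlim2 := (hlim.const_mul C).mul_const D
  simp only [mul_zero, zero_mul] at hlim2
  rw [tendsto_iff_norm_sub_tendsto_zero]
  refine squeeze_zero' (Eventually.of_forall fun _ => norm_nonneg _) ?_ hlim2
  filter_upwards [eventually_gt_atTop 0] with n hn
  have hn' : (0 : ℝ) < n := by exact_mod_cast hn
  have hB : exp (X + Y) = exp ((n : ℝ)⁻¹ • (X + Y)) ^ n := by
    rw [hpow, mul_inv_cancel₀ hn'.ne', one_smul]
  rw [hB]
  -- The powers of `exp ((X + Y)/n)` up to the `n`-th are values at times `j/n` in `[0, 1]`, hence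
  -- bounded by compactness.
  refine norm_pow_sub_pow_le n (fun j => hC _ j) fun j hj => ?_
  rw [hpow]
  refine hD _ ⟨by positivity, ?_⟩
  rw [← div_eq_mul_inv]
  exact div_le_one_of_le₀ (by exact_mod_cast hj) hn'.le

/-- The real vector space of all `X` whose one-parameter group stays in the closed bounded
monoid `K`. -/
noncomputable def tangentSpace (K : Submonoid 𝔸) (hK : IsClosed (K : Set 𝔸)) {C : ℝ}
    (hC : ∀ u ∈ K, ‖u‖ ≤ C) : Submodule ℝ 𝔸 where
  carrier := {X | ∀ t : ℝ, exp (t • X) ∈ K}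
  zero_mem' t := by simp
  smul_mem' c X hX t := by rw [smul_smul]; exact hX _
  add_mem' {X Y} hX hY t := by
    rw [smul_add]
    refine hK.mem_of_tendsto (tendsto_exp_mul_exp_pow (t • X) (t • Y) (C := C) fun s j => ?_)
      (Eventually.of_forall fun n => ?_)
    · rw [smul_smul, smul_smul]
      exact hC _ (K.pow_mem (K.mul_mem (hX _) (hY _)) _)
    · rw [smul_smul, smul_smul]
      exact K.pow_mem (K.mul_mem (hX _) (hY _)) _

variable {K : Submonoid 𝔸} {hK : IsClosed (K : Set 𝔸)} {C : ℝ} {hC : ∀ u ∈ K, ‖u‖ ≤ C}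

theorem mem_tangentSpace {X : 𝔸} : X ∈ tangentSpace K hK hC ↔ ∀ t : ℝ, exp (t • X) ∈ K := Iff.rfl

theorem mem_tangentSpace_iff_complex {X : 𝔸} :
    X ∈ tangentSpace K hK hC ↔ ∀ t : ℝ, exp ((t : ℂ) • X) ∈ K := by
  simp only [Complex.coe_smul, mem_tangentSpace]

theorem isClosed_tangentSpace : IsClosed (tangentSpace K hK hC : Set 𝔸) := by
  let _ : NormedAlgebra ℚ 𝔸 := NormedAlgebra.restrictScalars ℚ ℂ 𝔸
  have : (tangentSpace K hK hC : Set 𝔸) = ⋂ t : ℝ, {X | exp (t • X) ∈ K} := by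
    ext X
    simp [mem_tangentSpace]
  rw [this]
  exact isClosed_iInter fun t =>
    hK.preimage ((exp_continuous (𝔸 := 𝔸)).comp (continuous_const_smul t))

theorem exp_conj_mem_tangentSpace {X Y : 𝔸} (hX : X ∈ tangentSpace K hK hC)
    (hY : Y ∈ tangentSpace K hK hC) (s : ℝ) :
    exp (s • X) * Y * exp (s • -X) ∈ tangentSpace K hK hC := by
  let _ : NormedAlgebra ℚ 𝔸 := NormedAlgebra.restrictScalars ℚ ℂ 𝔸
  intro t
  have h1 : exp (s • X) * exp (s • -X) = 1 := by
    rw [smul_neg, ← exp_add_of_commute (Commute.neg_right (Commute.refl _)), add_neg_cancel,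
      exp_zero]
  have h2 : exp (s • -X) * exp (s • X) = 1 := by
    rw [smul_neg, ← exp_add_of_commute (Commute.neg_left (Commute.refl _)), neg_add_cancel,
      exp_zero]
  have h := exp_units_conj (⟨_, _, h1, h2⟩ : 𝔸ˣ) (t • Y)
  simp only [Units.val_mk, Units.inv_mk, mul_smul_comm, smul_mul_assoc] at h
  rw [h]
  have hX' : exp (s • -X) ∈ K := by
    rw [smul_neg, ← neg_smul]
    exact hX _
  exact K.mul_mem (K.mul_mem (hX s) (hY t)) hX'

/-- The commutator is the derivative at 0 of `exp (sX) Y exp (-sX)`, a curve in the tangent space,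
and that subspace is closed. -/
theorem commutator_mem_tangentSpace {X Y : 𝔸} (hX : X ∈ tangentSpace K hK hC)
    (hY : Y ∈ tangentSpace K hK hC) : X * Y - Y * X ∈ tangentSpace K hK hC := by
  have h := ((hasDerivAt_exp_smul_const (𝕂 := ℝ) X 0).mul_const Y).mul
    (hasDerivAt_exp_smul_const (𝕂 := ℝ) (-X) 0)
  simp only [zero_smul, exp_zero, one_mul, mul_one] at h
  have e : X * Y + Y * -X = X * Y - Y * X := by noncomm_ring
  rw [e] at h
  refine isClosed_tangentSpace.mem_of_tendsto (hasDerivAt_iff_tendsto_slope_zero.1 h)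
    (Eventually.of_forall fun s => ?_)
  refine Submodule.smul_mem _ _ (Submodule.sub_mem _ ?_ ?_)
  · exact exp_conj_mem_tangentSpace hX hY _
  · exact exp_conj_mem_tangentSpace hX hY _

variable (K hK hC) in
/-- The complex Lie algebra spanned by the tangent space of `K`. -/
noncomputable def complexTangentAlgebra : Submodule ℂ 𝔸 where
  carrier := {A | ∃ X ∈ tangentSpace K hK hC, ∃ Y ∈ tangentSpace K hK hC, A = X + Complex.I • Y}
  zero_mem' := ⟨0, zero_mem _, 0, zero_mem _, by simp⟩
  add_mem' := by
    rintro _ _ ⟨X, hX, Y, hY, rfl⟩ ⟨X', hX', Y', hY', rfl⟩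
    exact ⟨X + X', add_mem hX hX', Y + Y', add_mem hY hY', by module⟩
  smul_mem' := by
    rintro c _ ⟨X, hX, Y, hY, rfl⟩
    refine ⟨c.re • X - c.im • Y, sub_mem (Submodule.smul_mem _ _ hX) (Submodule.smul_mem _ _ hY),
      c.im • X + c.re • Y, add_mem (Submodule.smul_mem _ _ hX) (Submodule.smul_mem _ _ hY), ?_⟩
    simp only [← Complex.coe_smul, smul_add, smul_smul]
    nth_rw 1 2 [← Complex.re_add_im c]
    have hI : ((c.re : ℂ) + c.im * Complex.I) * Complex.I = c.re * Complex.I - c.im := by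
      linear_combination (c.im : ℂ) * Complex.I_mul_I
    rw [hI]
    module

theorem mem_complexTangentAlgebra {A : 𝔸} : A ∈ complexTangentAlgebra K hK hC ↔
    ∃ X ∈ tangentSpace K hK hC, ∃ Y ∈ tangentSpace K hK hC, A = X + Complex.I • Y := Iff.rfl

theorem commutator_mem_complexTangentAlgebra {A B : 𝔸} (hA : A ∈ complexTangentAlgebra K hK hC)
    (hB : B ∈ complexTangentAlgebra K hK hC) :
    A * B - B * A ∈ complexTangentAlgebra K hK hC := by
  obtain ⟨X, hX, Y, hY, rfl⟩ := hA
  obtain ⟨X', hX', Y', hY', rfl⟩ := hB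
  refine ⟨(X * X' - X' * X) - (Y * Y' - Y' * Y),
    sub_mem (commutator_mem_tangentSpace hX hX') (commutator_mem_tangentSpace hY hY'),
    (X * Y' - Y' * X) + (Y * X' - X' * Y),
    add_mem (commutator_mem_tangentSpace hX hY') (commutator_mem_tangentSpace hY hX'), ?_⟩
  simp only [add_mul, mul_add, smul_mul_assoc, mul_smul_comm, smul_add, smul_smul,
    Complex.I_mul_I]
  module

end TangentSpace

/-! ### Commutators of Pauli operators on three sites -/

section PauliAlgebra

variable {R : Type*} [Ring R]

/-- The relations satisfied by the Pauli operators `x = σ_x` and `z = σ_z` of one qubit. -/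
structure PauliPair (x z : R) : Prop where
  x_mul_x : x * x = 1
  z_mul_z : z * z = 1
  z_mul_x : z * x = -(x * z)

/-- The operators of one qubit commute with those of another one. -/
structure PauliCommute (x z x' z' : R) : Prop where
  xx : x' * x = x * x'
  xz : x' * z = z * x'
  zx : z' * x = x * z'
  zz : z' * z = z * z'

theorem mul_mul_eq_of_mul_eq {a b c : R} (h : a * b = c) (d : R) : a * (b * d) = c * d := by
  rw [← mul_assoc, h]

variable [Algebra ℂ R]

/-- A space of operators which is closed under commutators. -/
def CommutatorClosed (M : Submodule ℂ R) : Prop :=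
  ∀ ⦃A⦄, A ∈ M → ∀ ⦃B⦄, B ∈ M → A * B - B * A ∈ M

variable {M : Submodule ℂ R}

theorem mem_of_smul_mem {A : R} {c : ℂ} (hc : c ≠ 0) (h : c • A ∈ M) : A ∈ M :=
  (Submodule.smul_mem_iff M hc).1 h

namespace CommutatorClosed

/-- If `s` commutes with `u` and anticommutes with `v`, then `M` contains `v` together with
`s` and `u + v`. -/
theorem mem_of_anticommute (hM : CommutatorClosed M) {s u v : R} {c : ℂ} (hc : c ≠ 0)
    (hs : s * s = c • 1) (hsM : s ∈ M) (huv : u + v ∈ M) (hu : s * u = u * s)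
    (hv : s * v = -(v * s)) : v ∈ M := by
  have h := hM hsM (hM hsM huv)
  have hv' : v * s = -(s * v) := by rw [hv, neg_neg]
  -- The commutator with `s`, applied twice, kills `u` and multiplies `v` by `4c`.
  have e : s * (s * (u + v) - (u + v) * s) - (s * (u + v) - (u + v) * s) * s = (4 * c) • v := by
    have h1 : s * (u + v) - (u + v) * s = (2 : ℂ) • (s * v) := by
      rw [mul_add, add_mul, hu, hv']; module
    have h2 : s * (s * v) = c • v := by rw [← mul_assoc, hs, smul_mul_assoc, one_mul]
    have h3 : s * v * s = -(c • v) := by rw [mul_assoc, hv', mul_neg, h2]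
    rw [h1, mul_smul_comm, smul_mul_assoc, h2, h3]
    module
  rw [e] at h
  exact mem_of_smul_mem (by simpa using hc) h

theorem mem_of_anticommute' (hM : CommutatorClosed M) {s u v : R} {c : ℂ} (hc : c ≠ 0)
    (hs : s * s = c • 1) (hsM : s ∈ M) (huv : u + v ∈ M) (hu : s * u = u * s)
    (hv : s * v = -(v * s)) : u ∈ M := by
  simpa using M.sub_mem huv (hM.mem_of_anticommute hc hs hsM huv hu hv)

end CommutatorClosed

variable {x₁ z₁ x₂ z₂ x₃ z₃ : R}

-- Iterated commutators of the two Hamiltonians `a` and `b` stay among few combinations of Pauli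
-- products; enough of them isolate one product `W`, which then splits both Hamiltonians by
-- (anti)commutation.
set_option linter.unusedSimpArgs false in
set_option maxHeartbeats 2000000 in
theorem y_mem_of_chain {M : Submodule ℂ R} (hM : CommutatorClosed M)
    (h₁ : PauliPair x₁ z₁) (h₂ : PauliPair x₂ z₂) (h₃ : PauliPair x₃ z₃)
    (h₁₂ : PauliCommute x₁ z₁ x₂ z₂) (h₁₃ : PauliCommute x₁ z₁ x₃ z₃)
    (h₂₃ : PauliCommute x₂ z₂ x₃ z₃)
    (ha : x₁ + z₂ + x₁ * x₂ + z₁ * z₂ ∈ M) (hb : x₂ + z₃ + x₂ * x₃ + z₂ * z₃ ∈ M) :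
    x₂ * z₂ ∈ M := by
  obtain ⟨a1, a2, a3⟩ := h₁
  obtain ⟨b1, b2, b3⟩ := h₂
  obtain ⟨c1, c2, c3⟩ := h₃
  obtain ⟨p1, p2, p3, p4⟩ := h₁₂
  obtain ⟨q1, q2, q3, q4⟩ := h₁₃
  obtain ⟨r1, r2, r3, r4⟩ := h₂₃
  have a1' := mul_mul_eq_of_mul_eq a1
  have a2' := mul_mul_eq_of_mul_eq a2
  have a3' := mul_mul_eq_of_mul_eq a3
  have b1' := mul_mul_eq_of_mul_eq b1
  have b2' := mul_mul_eq_of_mul_eq b2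
  have b3' := mul_mul_eq_of_mul_eq b3
  have c1' := mul_mul_eq_of_mul_eq c1
  have c2' := mul_mul_eq_of_mul_eq c2
  have c3' := mul_mul_eq_of_mul_eq c3
  have p1' := mul_mul_eq_of_mul_eq p1
  have p2' := mul_mul_eq_of_mul_eq p2
  have p3' := mul_mul_eq_of_mul_eq p3
  have p4' := mul_mul_eq_of_mul_eq p4
  have q1' := mul_mul_eq_of_mul_eq q1
  have q2' := mul_mul_eq_of_mul_eq q2
  have q3' := mul_mul_eq_of_mul_eq q3
  have q4' := mul_mul_eq_of_mul_eq q4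
  have r1' := mul_mul_eq_of_mul_eq r1
  have r2' := mul_mul_eq_of_mul_eq r2
  have r3' := mul_mul_eq_of_mul_eq r3
  have r4' := mul_mul_eq_of_mul_eq r4
  set a := x₁ + z₂ + x₁ * x₂ + z₁ * z₂ with ha_def
  set b := x₂ + z₃ + x₂ * x₃ + z₂ * z₃ with hb_def
  -- These are the blocks met in the iterated commutators. Exchanging `x` with `z` and site 1 with
  -- site 3 swaps `a` with `b`, and, up to sign, `B` with `C` and `D` with `E`, while fixing `A`,
  -- `F`, `W` up to sign.
  obtain ⟨W, hW⟩ : ∃ W, W = x₁ * (x₂ * (z₂ * z₃)) := ⟨_, rfl⟩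
  obtain ⟨A, hA⟩ : ∃ A, A = (1 + z₁) * (x₂ * z₂) * (1 + x₃) := ⟨_, rfl⟩
  obtain ⟨B, hB⟩ : ∃ B, B = x₁ * z₁ * (1 + x₂) * (1 + x₃) := ⟨_, rfl⟩
  obtain ⟨C, hC⟩ : ∃ C, C = (1 + z₁) * (1 + z₂) * (x₃ * z₃) := ⟨_, rfl⟩
  obtain ⟨D, hD⟩ : ∃ D, D = (x₁ * z₁ * z₂ + x₁ * (x₂ * z₂)) * (1 + x₃) := ⟨_, rfl⟩
  obtain ⟨E, hE⟩ : ∃ E, E = (1 + z₁) * (x₂ * z₂ * z₃ + x₂ * (x₃ * z₃)) := ⟨_, rfl⟩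
  obtain ⟨F, hF⟩ : ∃ F, F = x₁ * z₁ * (1 + z₂ + x₂) * z₃ + x₁ * (x₂ * z₂) * z₃
      + x₁ * (1 + z₂ + x₂) * (x₃ * z₃) + x₁ * z₁ * (x₂ * z₂) * (x₃ * z₃) := ⟨_, rfl⟩
  have e : (b * a - a * b = (2 : ℂ) • (A - W)) ∧
      (a * (a * (A - W) - (A - W) * a) - (a * (A - W) - (A - W) * a) * a
        = (20 : ℂ) • (A - W) - (12 : ℂ) • (B - W)) ∧
      (b * (b * (A - W) - (A - W) * b) - (b * (A - W) - (A - W) * b) * b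
        = (20 : ℂ) • (A - W) - (12 : ℂ) • (C - W)) ∧
      ((A - B) * (A - C) - (A - C) * (A - B) = (2 : ℂ) • F - (4 : ℂ) • D - (4 : ℂ) • E) ∧
      ((A - B) * (F - (2 : ℂ) • D - (2 : ℂ) • E) - (F - (2 : ℂ) • D - (2 : ℂ) • E) * (A - B)
        = (4 : ℂ) • E + (4 : ℂ) • F - (8 : ℂ) • A - (8 : ℂ) • B + (12 : ℂ) • C) ∧
      ((A - C) * (F - (2 : ℂ) • D - (2 : ℂ) • E) - (F - (2 : ℂ) • D - (2 : ℂ) • E) * (A - C)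
        = (8 : ℂ) • A - (12 : ℂ) • B + (8 : ℂ) • C - (4 : ℂ) • D - (4 : ℂ) • F) ∧
      ((A - B) * ((2 : ℂ) • A - (3 : ℂ) • B + (2 : ℂ) • C - D - F)
          - ((2 : ℂ) • A - (3 : ℂ) • B + (2 : ℂ) • C - D - F) * (A - B)
        = (4 : ℂ) • (D + E - F - A - B - C)) ∧
      (W * W = (-1 : ℂ) • 1 ∧ W * z₁ = -(z₁ * W) ∧ W * x₁ = x₁ * W ∧ W * z₂ = -(z₂ * W) ∧
        W * x₂ = -(x₂ * W) ∧ W * z₃ = z₃ * W ∧ W * x₃ = -(x₃ * W)) ∧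
      ((z₂ + x₁ * x₂) * (x₂ + z₂ * z₃) - (x₂ + z₂ * z₃) * (z₂ + x₁ * x₂)
        = (2 : ℂ) • (W - x₂ * z₂)) := by
    simp only [hW, hA, hB, hC, hD, hE, hF, ha_def, hb_def]
    refine ⟨?_, ?_, ?_, ?_, ?_, ?_, ?_, ⟨?_, ?_, ?_, ?_, ?_, ?_, ?_⟩, ?_⟩ <;>
    · simp only [mul_add, add_mul, mul_sub, sub_mul, mul_neg, neg_mul, neg_neg, mul_one, one_mul,
        mul_smul_comm, smul_mul_assoc, mul_assoc, a1, a2, a3, b1, b2, b3, c1, c2, c3,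
        a1', a2', a3', b1', b2', b3', c1', c2', c3', p1, p2, p3, p4, q1, q2, q3, q4, r1, r2, r3, r4,
        p1', p2', p3', p4', q1', q2', q3', q4', r1', r2', r3', r4']
      try module
  obtain ⟨e1, e2, e3, e4, e5, e6, e7, ⟨f, g1, f1, g2, f2, g3, f3⟩, e8⟩ := e
  have m1 : A - W ∈ M := by
    have h := hM hb ha
    rw [e1] at h
    exact mem_of_smul_mem (by norm_num) h
  have m2 : A - B ∈ M := by
    have h := hM ha (hM ha m1)
    rw [e2] at h
    refine mem_of_smul_mem (c := 12) (by norm_num) ?_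
    convert M.sub_mem h (M.smul_mem 8 m1) using 1
    module
  have m3 : A - C ∈ M := by
    have h := hM hb (hM hb m1)
    rw [e3] at h
    refine mem_of_smul_mem (c := 12) (by norm_num) ?_
    convert M.sub_mem h (M.smul_mem 8 m1) using 1
    module
  have m4 : F - (2 : ℂ) • D - (2 : ℂ) • E ∈ M := by
    have h := hM m2 m3
    rw [e4] at h
    refine mem_of_smul_mem (c := 2) (by norm_num) ?_
    convert h using 1
    module
  have m5 := hM m2 m4
  rw [e5] at m5
  have m6 : (2 : ℂ) • A - (3 : ℂ) • B + (2 : ℂ) • C - D - F ∈ M := by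
    have h := hM m3 m4
    rw [e6] at h
    refine mem_of_smul_mem (c := 4) (by norm_num) ?_
    convert h using 1
    module
  have m7 := hM m2 m6
  rw [e7] at m7
  -- The six relations `m2` to `m7` are linear in `A, …, F`; these coefficients solve the system for
  -- `A`.
  have mA : A ∈ M := by
    have h := M.add_mem (M.add_mem (M.add_mem (M.smul_mem (4 / 17) m2) (M.smul_mem (4 / 17) m3))
      (M.add_mem (M.smul_mem (-3 / 17) m4) (M.smul_mem (-1 / 68) m5)))
      (M.add_mem (M.smul_mem (1 / 17) m6) (M.smul_mem (-5 / 68) m7))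
    convert h using 1
    module
  have mW : W ∈ M := by simpa using M.sub_mem mA m1
  -- `W` squares to `-1`, commutes with `x₁` and `z₁ z₂`, and anticommutes with `z₂` and `x₁ x₂`.
  -- For `b` it likewise singles out `x₂ + z₂ z₃`, and the commutator of the two pieces is `2 (W -
  -- x₂ z₂)`.
  have n1 : z₂ + x₁ * x₂ ∈ M := by
    refine hM.mem_of_anticommute (s := W) (u := x₁ + z₁ * z₂) (by norm_num) f mW ?_ ?_ ?_
    · convert ha using 1
      rw [ha_def]
      abel
    · rw [mul_add, add_mul, f1, ← mul_assoc, g1, neg_mul, mul_assoc, g2]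
      noncomm_ring
    · rw [mul_add, add_mul, g2, ← mul_assoc, f1, mul_assoc, f2]
      noncomm_ring
  have n2 : x₂ + z₂ * z₃ ∈ M := by
    refine hM.mem_of_anticommute (s := W) (u := z₃ + x₂ * x₃) (by norm_num) f mW ?_ ?_ ?_
    · convert hb using 1
      rw [hb_def]
      abel
    · rw [mul_add, add_mul, g3, ← mul_assoc, f2, neg_mul, mul_assoc, f3]
      noncomm_ring
    · rw [mul_add, add_mul, f2, ← mul_assoc, g2, neg_mul, mul_assoc, g3]
      noncomm_ring
  have h := hM n1 n2
  rw [e8] at h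
  simpa using M.sub_mem mW (mem_of_smul_mem (by norm_num) h)

end PauliAlgebra

/-! ### Pauli operators on bit strings -/

section QubitOperators

open Matrix

variable {ι : Type*} [DecidableEq ι]

/-- Flip the bit at the site `k`. -/
def flipBit (k : ι) (x : ι → Fin 2) : ι → Fin 2 := Function.update x k (1 - x k)

theorem flipBit_self (k : ι) (x : ι → Fin 2) : flipBit k x k = 1 - x k := by simp [flipBit]

theorem flipBit_of_ne {j k : ι} (h : j ≠ k) (x : ι → Fin 2) : flipBit k x j = x j := by
  simp [flipBit, h]

theorem flipBit_flipBit (k : ι) (x : ι → Fin 2) : flipBit k (flipBit k x) = x := by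
  simp [flipBit]

theorem flipBit_comm (j k : ι) (x : ι → Fin 2) :
    flipBit j (flipBit k x) = flipBit k (flipBit j x) := by
  rcases eq_or_ne j k with rfl | h
  · rfl
  · simp [flipBit, h, h.symm, Function.update_comm h]

theorem eq_flipBit_iff {k : ι} {x y : ι → Fin 2} : y = flipBit k x ↔ x = flipBit k y :=
  ⟨fun h => by rw [h, flipBit_flipBit], fun h => by rw [h, flipBit_flipBit]⟩

/-- The sign `(-1)ᵇ` of a bit `b`. -/
def bitSign (b : Fin 2) : ℂ := ![1, -1] b

theorem bitSign_mul_self (b : Fin 2) : bitSign b * bitSign b = 1 := by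
  fin_cases b <;> simp [bitSign]

theorem bitSign_one_sub (b : Fin 2) : bitSign (1 - b) = -bitSign b := by
  fin_cases b <;> simp [bitSign]

theorem one_add_bitSign_mul_bitSign (b c : Fin 2) :
    1 + bitSign b * bitSign c = if c = b then 2 else 0 := by
  fin_cases b <;> fin_cases c <;> simp [bitSign] <;> norm_num

variable [Fintype ι]

/-- The Pauli operator `σ_x` at the site `k`. -/
def siteX (k : ι) : Matrix (ι → Fin 2) (ι → Fin 2) ℂ :=
  Matrix.of fun x y => if y = flipBit k x then 1 else 0

/-- The Pauli operator `σ_z` at the site `k`. -/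
def siteZ (k : ι) : Matrix (ι → Fin 2) (ι → Fin 2) ℂ :=
  diagonal fun x => bitSign (x k)

theorem siteX_mul_apply (k : ι) (A : Matrix (ι → Fin 2) (ι → Fin 2) ℂ) (x y : ι → Fin 2) :
    (siteX k * A) x y = A (flipBit k x) y := by
  simp [siteX, mul_apply]

theorem siteX_apply (k : ι) (x y : ι → Fin 2) :
    siteX k x y = if y = flipBit k x then 1 else 0 := rfl

theorem siteZ_mul_apply (k : ι) (A : Matrix (ι → Fin 2) (ι → Fin 2) ℂ) (x y : ι → Fin 2) :
    (siteZ k * A) x y = bitSign (x k) * A x y := by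
  simp [siteZ]

theorem mul_siteZ_apply (k : ι) (A : Matrix (ι → Fin 2) (ι → Fin 2) ℂ) (x y : ι → Fin 2) :
    (A * siteZ k) x y = A x y * bitSign (y k) := by
  simp [siteZ]

theorem pauliPair_site (k : ι) : PauliPair (siteX k) (siteZ k) where
  x_mul_x := by
    ext x y
    simp [siteX_mul_apply, siteX_apply, flipBit_flipBit, one_apply, eq_comm]
  z_mul_z := by
    simp [siteZ, bitSign_mul_self]
  z_mul_x := by
    ext x y
    rw [neg_apply, siteZ_mul_apply, mul_siteZ_apply, siteX_apply]
    split_ifs with h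
    · rw [h, flipBit_self, bitSign_one_sub]
      ring
    · simp

theorem siteZ_mul_siteZ_comm (j k : ι) : siteZ k * siteZ j = siteZ j * siteZ k := by
  simp [siteZ, mul_comm]

theorem siteX_mul_siteZ_comm {j k : ι} (h : j ≠ k) : siteX k * siteZ j = siteZ j * siteX k := by
  ext x y
  rw [siteZ_mul_apply, mul_siteZ_apply, siteX_apply]
  split_ifs with hy
  · rw [hy, flipBit_of_ne h]
    ring
  · simp

theorem pauliCommute_site {j k : ι} (h : j ≠ k) :
    PauliCommute (siteX j) (siteZ j) (siteX k) (siteZ k) where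
  xx := by
    ext x y
    rw [siteX_mul_apply, siteX_mul_apply, siteX_apply, siteX_apply, flipBit_comm]
  xz := siteX_mul_siteZ_comm h
  zx := (siteX_mul_siteZ_comm h.symm).symm
  zz := siteZ_mul_siteZ_comm j k

theorem isHermitian_siteX (k : ι) : (siteX k : Matrix (ι → Fin 2) (ι → Fin 2) ℂ).IsHermitian := by
  ext x y
  rw [conjTranspose_apply, siteX_apply, siteX_apply]
  simp only [eq_flipBit_iff (x := y)]
  split_ifs <;> simp

set_option linter.unusedSectionVars false in
theorem isHermitian_siteZ (k : ι) : (siteZ k : Matrix (ι → Fin 2) (ι → Fin 2) ℂ).IsHermitian := by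
  ext x y
  rw [conjTranspose_apply, siteZ, diagonal_apply, diagonal_apply]
  by_cases h : x = y
  · subst h
    simp only [if_true, bitSign]
    generalize x k = b
    fin_cases b <;> simp
  · simp [h, Ne.symm h]

end QubitOperators

/-! ### Two-qubit operators inside the register -/

section ActOn

open Matrix

variable {l : ℕ} {a b : Fin l}

/-- Two bit strings agree at all sites except possibly `a` and `b`. -/
def AgreeOff (a b : Fin l) (x y : Fin l → Fin 2) : Prop := ∀ j, j ≠ a → j ≠ b → x j = y j

instance (a b : Fin l) (x y : Fin l → Fin 2) : Decidable (AgreeOff a b x y) :=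
  inferInstanceAs (Decidable (∀ j, j ≠ a → j ≠ b → x j = y j))

theorem actOn_apply (A : Matrix (Fin 2 × Fin 2) (Fin 2 × Fin 2) ℂ) (a b : Fin l)
    (x y : Fin l → Fin 2) :
    actOn A a b x y = if AgreeOff a b x y then A (x a, x b) (y a, y b) else 0 := rfl

theorem eq_of_agreeOff {x y : Fin l → Fin 2} (h : AgreeOff a b x y) (ha : x a = y a)
    (hb : x b = y b) : x = y := by
  funext j
  by_cases h1 : j = a
  · rw [h1, ha]
  by_cases h2 : j = b
  · rw [h2, hb]
  exact h j h1 h2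

theorem actOn_add (A B : Matrix (Fin 2 × Fin 2) (Fin 2 × Fin 2) ℂ) (a b : Fin l) :
    actOn (A + B) a b = actOn A a b + actOn B a b := by
  ext x y
  simp only [actOn_apply, Matrix.add_apply]
  split_ifs <;> simp

theorem actOn_smul (c : ℂ) (A : Matrix (Fin 2 × Fin 2) (Fin 2 × Fin 2) ℂ) (a b : Fin l) :
    actOn (c • A) a b = c • actOn A a b := by
  ext x y
  simp only [actOn_apply, Matrix.smul_apply]
  split_ifs <;> simp

theorem actOn_one (a b : Fin l) : actOn (1 : Matrix (Fin 2 × Fin 2) (Fin 2 × Fin 2) ℂ) a b = 1 := by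
  ext x y
  rw [actOn_apply, one_apply, one_apply]
  by_cases h : x = y
  · subst h
    simp [AgreeOff]
  · rw [if_neg h]
    split_ifs with h1 h2
    · rw [Prod.mk.injEq] at h2
      exact absurd (eq_of_agreeOff h1 h2.1 h2.2) h
    · rfl
    · rfl

theorem actOn_mul (hab : a ≠ b) (A B : Matrix (Fin 2 × Fin 2) (Fin 2 × Fin 2) ℂ) :
    actOn (A * B) a b = actOn A a b * actOn B a b := by
  ext x y
  rw [actOn_apply, mul_apply, mul_apply]
  -- Only the four strings that agree with `x` off `a` and `b` contribute to the matrix product.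
  let e (c : Fin 2 × Fin 2) : Fin l → Fin 2 := Function.update (Function.update x a c.1) b c.2
  have ea (c) : e c a = c.1 := by simp [e, hab]
  have eb (c) : e c b = c.2 := by simp [e]
  have eo (c) : AgreeOff a b x (e c) := fun j h1 h2 => by simp [e, h1, h2]
  have he : Function.Injective e := fun c d h => by
    ext1
    · rw [← ea c, h, ea]
    · rw [← eb c, h, eb]
  split_ifs with hxy
  · refine Fintype.sum_of_injective e he _ _ (fun w hw => ?_) fun c => ?_
    · rw [actOn_apply, if_neg, zero_mul]
      intro h
      refine hw ⟨(w a, w b), ?_⟩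
      refine eq_of_agreeOff (a := a) (b := b) (fun j h1 h2 => ?_) (ea _) (eb _)
      rw [← eo _ j h1 h2, h j h1 h2]
    · rw [actOn_apply, actOn_apply, if_pos (eo c), if_pos, ea, eb]
      intro j h1 h2
      rw [← eo c j h1 h2, hxy j h1 h2]
  · symm
    refine Finset.sum_eq_zero fun w _ => ?_
    rw [actOn_apply, actOn_apply]
    split_ifs with h1 h2
    · exact absurd (fun j ha hb => (h1 j ha hb).trans (h2 j ha hb)) hxy
    all_goals simp

/-- Acting on two given qubits is a homomorphism of algebras. -/
def actOnHom (hab : a ≠ b) : Matrix (Fin 2 × Fin 2) (Fin 2 × Fin 2) ℂ →ₐ[ℂ]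
    Matrix (Fin l → Fin 2) (Fin l → Fin 2) ℂ :=
  AlgHom.ofLinearMap
    { toFun := fun A => actOn A a b
      map_add' := fun A B => actOn_add A B a b
      map_smul' := fun c A => actOn_smul c A a b }
    (actOn_one a b) (actOn_mul hab)

theorem actOnHom_apply (hab : a ≠ b) (A : Matrix (Fin 2 × Fin 2) (Fin 2 × Fin 2) ℂ) :
    actOnHom hab A = actOn A a b := rfl

theorem pauliX_apply (p q : Fin 2) : pauliX p q = if q = 1 - p then 1 else 0 := by
  fin_cases p <;> fin_cases q <;> simp [pauliX]

theorem pauliZ_apply (p q : Fin 2) : pauliZ p q = if p = q then bitSign p else 0 := by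
  fin_cases p <;> fin_cases q <;> simp [pauliZ, bitSign]

theorem actOn_pauliX_one (hab : a ≠ b) : actOn (pauliX ⊗ₖ 1) a b = siteX a := by
  ext x y
  rw [actOn_apply, siteX_apply, kronecker_apply, pauliX_apply, one_apply]
  by_cases h : y = flipBit a x
  · have h1 : AgreeOff a b x y := fun j hj _ => by rw [h, flipBit_of_ne hj]
    rw [if_pos h1]
    simp [h, flipBit_self, flipBit_of_ne hab.symm]
  · rw [if_neg h]
    split_ifs with h1 h2 h3 <;> try simp only [mul_zero, zero_mul]
    refine absurd (eq_of_agreeOff (a := a) (b := b) (fun j hj hj' => ?_) ?_ ?_) h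
    · rw [flipBit_of_ne hj, h1 j hj hj']
    · rw [flipBit_self, h2]
    · rw [flipBit_of_ne hab.symm, h3]

theorem actOn_one_pauliX (hab : a ≠ b) : actOn (1 ⊗ₖ pauliX) a b = siteX b := by
  ext x y
  rw [actOn_apply, siteX_apply, kronecker_apply, pauliX_apply, one_apply]
  by_cases h : y = flipBit b x
  · have h1 : AgreeOff a b x y := fun j _ hj => by rw [h, flipBit_of_ne hj]
    rw [if_pos h1]
    simp [h, flipBit_self, flipBit_of_ne hab]
  · rw [if_neg h]
    split_ifs with h1 h2 h3 <;> try simp only [mul_zero, zero_mul]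
    refine absurd (eq_of_agreeOff (a := a) (b := b) (fun j hj hj' => ?_) ?_ ?_) h
    · rw [flipBit_of_ne hj', h1 j hj hj']
    · rw [flipBit_of_ne hab, h2]
    · rw [flipBit_self, h3]

theorem actOn_pauliZ_one (a b : Fin l) : actOn (pauliZ ⊗ₖ 1) a b = siteZ a := by
  ext x y
  rw [actOn_apply, siteZ, diagonal_apply, kronecker_apply, pauliZ_apply, one_apply]
  by_cases h : x = y
  · have h1 : AgreeOff a b x y := fun j _ _ => by rw [h]
    rw [if_pos h1]
    simp [h]
  · rw [if_neg h]
    split_ifs with h1 h2 h3 <;> try simp only [mul_zero, zero_mul]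
    exact absurd (eq_of_agreeOff h1 h2 h3) h

theorem actOn_one_pauliZ (a b : Fin l) : actOn (1 ⊗ₖ pauliZ) a b = siteZ b := by
  ext x y
  rw [actOn_apply, siteZ, diagonal_apply, kronecker_apply, pauliZ_apply, one_apply]
  by_cases h : x = y
  · have h1 : AgreeOff a b x y := fun j _ _ => by rw [h]
    rw [if_pos h1]
    simp [h]
  · rw [if_neg h]
    split_ifs with h1 h2 h3 <;> try simp only [mul_zero, zero_mul]
    exact absurd (eq_of_agreeOff h1 h2 h3) h

theorem actOn_hamiltonianH (hab : a ≠ b) : actOn hamiltonianH a b =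
    siteX a + siteZ b + siteX a * siteX b + siteZ a * siteZ b := by
  have hx : pauliX ⊗ₖ pauliX = (pauliX ⊗ₖ (1 : Matrix (Fin 2) (Fin 2) ℂ)) *
      ((1 : Matrix (Fin 2) (Fin 2) ℂ) ⊗ₖ pauliX) := by
    rw [← mul_kronecker_mul, mul_one, one_mul]
  have hz : pauliZ ⊗ₖ pauliZ = (pauliZ ⊗ₖ (1 : Matrix (Fin 2) (Fin 2) ℂ)) *
      ((1 : Matrix (Fin 2) (Fin 2) ℂ) ⊗ₖ pauliZ) := by
    rw [← mul_kronecker_mul, mul_one, one_mul]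
  rw [hamiltonianH, hx, hz, actOn_add, actOn_add, actOn_add, actOn_mul hab, actOn_mul hab,
    actOn_pauliX_one hab, actOn_one_pauliX hab, actOn_pauliZ_one, actOn_one_pauliZ]

theorem ringGate_eq_exp {k : Fin l} (hk : k ≠ cyclicSucc k) :
    ringGate l k = NormedSpace.exp (Complex.I • actOn hamiltonianH k (cyclicSucc k)) := by
  have hc : Continuous (actOnHom hk) :=
    LinearMap.continuous_of_finiteDimensional (actOnHom hk).toLinearMap
  rw [ringGate, gateG, ← actOn_smul, ← actOnHom_apply hk, ← actOnHom_apply hk]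
  open scoped Matrix.Norms.Operator in
  exact NormedSpace.map_exp (actOnHom hk) hc _

end ActOn

/-! ### Splitting the Hamiltonians into Pauli terms -/

section PauliGeneration

variable {R : Type*} [Ring R] [Algebra ℂ R] {M : Submodule ℂ R}

theorem PauliPair.y_mul_y {x z : R} (h : PauliPair x z) : x * z * (x * z) = (-1 : ℂ) • 1 := by
  rw [mul_assoc, ← mul_assoc z, h.z_mul_x, neg_mul, mul_neg, mul_assoc x z z, h.z_mul_z, mul_one,
    h.x_mul_x, neg_one_smul]

namespace CommutatorClosed

theorem z_mem {x z : R} (hM : CommutatorClosed M) (h : PauliPair x z) (hx : x ∈ M)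
    (hy : x * z ∈ M) : z ∈ M := by
  have h' := hM hx hy
  have e : x * (x * z) - x * z * x = (2 : ℂ) • z := by
    rw [mul_assoc x z x, h.z_mul_x, mul_neg, ← mul_assoc, h.x_mul_x, one_mul]
    module
  rw [e] at h'
  exact mem_of_smul_mem two_ne_zero h'

/-- The operator `x' z'` commutes with `x` and anticommutes with the three other terms of the
Hamiltonian. -/
theorem x_mem_of_edge {x z x' z' : R} (hM : CommutatorClosed M) (h' : PauliPair x' z')
    (hc : PauliCommute x z x' z') (hy : x' * z' ∈ M) (hh : x + z' + x * x' + z * z' ∈ M) :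
    x ∈ M := by
  refine hM.mem_of_anticommute' (u := x) (v := z' + x * x' + z * z') (c := -1) (by norm_num)
    h'.y_mul_y hy ?_ ?_ ?_
  · convert hh using 1
    abel
  · rw [mul_assoc, hc.zx, ← mul_assoc, hc.xx, mul_assoc]
  · have e1 : x' * z' * z' = -(z' * (x' * z')) := by
      rw [← mul_assoc, h'.z_mul_x, neg_mul, neg_neg]
    have e2 : x' * z' * x' = -(x' * (x' * z')) := by
      rw [mul_assoc, h'.z_mul_x, mul_neg]
    have e3 : x' * z' * (x * x') = -(x * x' * (x' * z')) := by
      rw [← mul_assoc, mul_assoc x', hc.zx, ← mul_assoc, hc.xx, mul_assoc x, mul_assoc x, e2,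
        mul_neg, mul_assoc]
    have e4 : x' * z' * (z * z') = -(z * z' * (x' * z')) := by
      rw [← mul_assoc, mul_assoc x', hc.zz, ← mul_assoc, hc.xz, mul_assoc z, mul_assoc z, e1,
        mul_neg, mul_assoc]
    rw [mul_add, mul_add, add_mul, add_mul, e1, e3, e4]
    abel

/-- Once `x` and `z'` are subtracted, `x` commutes with `x x'` and anticommutes with `z z'`. -/
theorem zz_mem_of_edge {x z x' z' : R} (hM : CommutatorClosed M) (h : PauliPair x z)
    (hc : PauliCommute x z x' z') (hx : x ∈ M) (hz' : z' ∈ M)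
    (hh : x + z' + x * x' + z * z' ∈ M) : z * z' ∈ M := by
  refine hM.mem_of_anticommute (s := x) (u := x * x') (c := 1) one_ne_zero
    (by rw [h.x_mul_x, one_smul]) hx ?_ ?_ ?_
  · convert M.sub_mem (M.sub_mem hh hx) hz' using 1
    abel
  · rw [mul_assoc, hc.xx]
  · rw [mul_assoc, hc.zx, ← mul_assoc, ← mul_assoc, h.z_mul_x, neg_mul, neg_neg]

variable {x₁ z₁ x₂ z₂ x₃ z₃ : R}

-- The two couplings first produce the three-site term `z₁ z₂ z₃`; commuting it with `x₁ z₂` removes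
-- `z₂`, and a commutator with `x₁` restores `z₁ z₃`.
set_option linter.unusedSimpArgs false in
theorem zz_mem_trans (hM : CommutatorClosed M)
    (h₁ : PauliPair x₁ z₁) (h₂ : PauliPair x₂ z₂)
    (h₁₂ : PauliCommute x₁ z₁ x₂ z₂) (h₁₃ : PauliCommute x₁ z₁ x₃ z₃)
    (h₂₃ : PauliCommute x₂ z₂ x₃ z₃) (hx₁ : x₁ ∈ M) (hy₁ : x₁ * z₁ ∈ M) (hx₂ : x₂ ∈ M)
    (hy₂ : x₂ * z₂ ∈ M) (h12 : z₁ * z₂ ∈ M) (h23 : z₂ * z₃ ∈ M) : z₁ * z₃ ∈ M := by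
  obtain ⟨a1, a2, a3⟩ := h₁
  obtain ⟨b1, b2, b3⟩ := h₂
  obtain ⟨p1, p2, p3, p4⟩ := h₁₂
  obtain ⟨q1, q2, q3, q4⟩ := h₁₃
  obtain ⟨r1, r2, r3, r4⟩ := h₂₃
  have a1' := mul_mul_eq_of_mul_eq a1
  have a2' := mul_mul_eq_of_mul_eq a2
  have a3' := mul_mul_eq_of_mul_eq a3
  have b1' := mul_mul_eq_of_mul_eq b1
  have b2' := mul_mul_eq_of_mul_eq b2
  have b3' := mul_mul_eq_of_mul_eq b3
  have p1' := mul_mul_eq_of_mul_eq p1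
  have p2' := mul_mul_eq_of_mul_eq p2
  have p3' := mul_mul_eq_of_mul_eq p3
  have p4' := mul_mul_eq_of_mul_eq p4
  have q3' := mul_mul_eq_of_mul_eq q3
  have q4' := mul_mul_eq_of_mul_eq q4
  have r3' := mul_mul_eq_of_mul_eq r3
  have r4' := mul_mul_eq_of_mul_eq r4
  have e : (x₂ * z₂ * (z₁ * z₂) - z₁ * z₂ * (x₂ * z₂) = (2 : ℂ) • (z₁ * x₂)) ∧
      (x₂ * (z₂ * z₃) - z₂ * z₃ * x₂ = (2 : ℂ) • (x₂ * z₂ * z₃)) ∧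
      (z₁ * x₂ * (x₂ * z₂ * z₃) - x₂ * z₂ * z₃ * (z₁ * x₂) = (2 : ℂ) • (z₁ * z₂ * z₃)) ∧
      (x₁ * z₁ * (z₁ * z₂) - z₁ * z₂ * (x₁ * z₁) = (2 : ℂ) • (x₁ * z₂)) ∧
      (z₁ * z₂ * z₃ * (x₁ * z₂) - x₁ * z₂ * (z₁ * z₂ * z₃) = (-2 : ℂ) • (x₁ * z₁ * z₃)) ∧
      (x₁ * (x₁ * z₁ * z₃) - x₁ * z₁ * z₃ * x₁ = (2 : ℂ) • (z₁ * z₃)) := by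
    refine ⟨?_, ?_, ?_, ?_, ?_, ?_⟩ <;>
    · simp only [mul_neg, neg_mul, neg_neg, mul_one, one_mul, mul_assoc, a1, a2, a3, b1, b2, b3,
        a1', a2', a3', b1', b2', b3', p1, p2, p3, p4, q1, q2, q3, q4, r1, r2, r3, r4,
        p1', p2', p3', p4', q3', q4', r3', r4']
      module
  obtain ⟨e1, e2, e3, e4, e5, e6⟩ := e
  have m1 := mem_of_smul_mem two_ne_zero (e1 ▸ hM hy₂ h12)
  have m2 := mem_of_smul_mem two_ne_zero (e2 ▸ hM hx₂ h23)
  have m3 := mem_of_smul_mem two_ne_zero (e3 ▸ hM m1 m2)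
  have m4 := mem_of_smul_mem two_ne_zero (e4 ▸ hM hy₁ h12)
  have m5 := mem_of_smul_mem (neg_ne_zero.2 two_ne_zero) (e5 ▸ hM m3 m4)
  exact mem_of_smul_mem two_ne_zero (e6 ▸ hM hx₁ m5)

end CommutatorClosed

end PauliGeneration

/-! ### The ring of sites -/

section Ring

variable {l : ℕ}

theorem cyclicSucc_val_of_lt {k : Fin l} (h : (k : ℕ) + 1 < l) :
    (cyclicSucc k : ℕ) = k + 1 := Nat.mod_eq_of_lt h

theorem cyclicSucc_val_of_eq {k : Fin l} (h : (k : ℕ) + 1 = l) : (cyclicSucc k : ℕ) = 0 := by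
  change (k + 1) % l = 0
  rw [h, Nat.mod_self]

theorem cyclicSucc_ne (hl : 3 ≤ l) (k : Fin l) : k ≠ cyclicSucc k := by
  intro h
  have h' := congrArg Fin.val h
  rcases Nat.lt_or_ge (k + 1) l with h1 | h1
  · rw [cyclicSucc_val_of_lt h1] at h'
    lia
  · rw [cyclicSucc_val_of_eq (by lia)] at h'
    lia

theorem cyclicSucc_cyclicSucc_ne (hl : 3 ≤ l) (k : Fin l) : k ≠ cyclicSucc (cyclicSucc k) := by
  intro h
  have h' := congrArg Fin.val h
  rcases Nat.lt_or_ge (k + 1) l with h1 | h1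
  · have e := cyclicSucc_val_of_lt h1
    rcases Nat.lt_or_ge (k + 1 + 1) l with h2 | h2
    · rw [cyclicSucc_val_of_lt (by lia)] at h'
      lia
    · rw [cyclicSucc_val_of_eq (by lia)] at h'
      lia
  · have e := cyclicSucc_val_of_eq (k := k) (by lia)
    rw [cyclicSucc_val_of_lt (by lia)] at h'
    lia

theorem exists_cyclicSucc_eq (k : Fin l) : ∃ j, cyclicSucc j = k := by
  rcases Nat.eq_zero_or_pos (k : ℕ) with h | h
  · refine ⟨⟨l - 1, by lia⟩, Fin.ext ?_⟩
    rw [cyclicSucc_val_of_eq (show l - 1 + 1 = l by lia), h]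
  · refine ⟨⟨k - 1, by lia⟩, Fin.ext ?_⟩
    rw [cyclicSucc_val_of_lt (show (k : ℕ) - 1 + 1 < l by lia)]
    change (k : ℕ) - 1 + 1 = k
    lia

variable {M : Submodule ℂ (Matrix (Fin l → Fin 2) (Fin l → Fin 2) ℂ)}

namespace CommutatorClosed

theorem siteY_mem (hl : 3 ≤ l) (hM : CommutatorClosed M)
    (hH : ∀ k : Fin l, actOn hamiltonianH k (cyclicSucc k) ∈ M) (k : Fin l) :
    siteX k * siteZ k ∈ M := by
  obtain ⟨j, rfl⟩ := exists_cyclicSucc_eq k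
  have h1 := hH j
  have h2 := hH (cyclicSucc j)
  rw [actOn_hamiltonianH (cyclicSucc_ne hl _)] at h1 h2
  exact y_mem_of_chain hM (pauliPair_site _) (pauliPair_site _) (pauliPair_site _)
    (pauliCommute_site (cyclicSucc_ne hl _)) (pauliCommute_site (cyclicSucc_cyclicSucc_ne hl _))
    (pauliCommute_site (cyclicSucc_ne hl _)) h1 h2

theorem siteX_mem (hl : 3 ≤ l) (hM : CommutatorClosed M)
    (hH : ∀ k : Fin l, actOn hamiltonianH k (cyclicSucc k) ∈ M) (k : Fin l) : siteX k ∈ M := by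
  have h := hH k
  rw [actOn_hamiltonianH (cyclicSucc_ne hl _)] at h
  exact hM.x_mem_of_edge (pauliPair_site _) (pauliCommute_site (cyclicSucc_ne hl _))
    (hM.siteY_mem hl hH _) h

theorem siteZ_mem (hl : 3 ≤ l) (hM : CommutatorClosed M)
    (hH : ∀ k : Fin l, actOn hamiltonianH k (cyclicSucc k) ∈ M) (k : Fin l) : siteZ k ∈ M :=
  hM.z_mem (pauliPair_site k) (hM.siteX_mem hl hH k) (hM.siteY_mem hl hH k)

theorem siteZ_mul_siteZ_mem (hl : 3 ≤ l) (hM : CommutatorClosed M)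
    (hH : ∀ k : Fin l, actOn hamiltonianH k (cyclicSucc k) ∈ M) {j k : Fin l} (hjk : j ≠ k) :
    siteZ j * siteZ k ∈ M := by
  have hsucc (k : Fin l) : siteZ k * siteZ (cyclicSucc k) ∈ M := by
    have h := hH k
    rw [actOn_hamiltonianH (cyclicSucc_ne hl _)] at h
    exact hM.zz_mem_of_edge (pauliPair_site _) (pauliCommute_site (cyclicSucc_ne hl _))
      (hM.siteX_mem hl hH _) (hM.siteZ_mem hl hH _) h
  -- Couplings are chained along the open line, by induction on the distance less one; the
  -- wrap-around edge is not needed.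
  have key (d : ℕ) : ∀ j k : Fin l, (k : ℕ) = j + d + 1 → siteZ j * siteZ k ∈ M := by
    induction d with
    | zero =>
      intro j k h
      have e : k = cyclicSucc j := Fin.ext (by rw [cyclicSucc_val_of_lt (by lia)]; exact h)
      rw [e]
      exact hsucc j
    | succ d ih =>
      intro j k h
      let i : Fin l := ⟨j + d + 1, by lia⟩
      have hik : k = cyclicSucc i := Fin.ext (by
        rw [cyclicSucc_val_of_lt (show (j : ℕ) + d + 1 + 1 < l by lia)]; exact h)
      have hi : (i : ℕ) = j + d + 1 := rfl
      have hji : j ≠ i := fun e => by have := congrArg Fin.val e; lia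
      have hjk : j ≠ k := fun e => by have := congrArg Fin.val e; lia
      have hik' : i ≠ k := fun e => by have := congrArg Fin.val e; lia
      exact hM.zz_mem_trans (pauliPair_site j) (pauliPair_site i) (pauliCommute_site hji)
        (pauliCommute_site hjk) (pauliCommute_site hik') (hM.siteX_mem hl hH _)
        (hM.siteY_mem hl hH _) (hM.siteX_mem hl hH _) (hM.siteY_mem hl hH _) (ih j i rfl)
        (hik ▸ hsucc i)
  rcases lt_or_gt_of_ne hjk with h | h
  · exact key (k - j - 1) j k (by have : (j : ℕ) < k := h; lia)
  · rw [siteZ_mul_siteZ_comm]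
    exact key (j - k - 1) k j (by have : (k : ℕ) < j := h; lia)

end CommutatorClosed

end Ring

/-! ### From Pauli operators to all traceless matrices -/

section MatrixUnits

open Matrix

variable {ι : Type*} [DecidableEq ι] [Fintype ι]

/-- The projection onto the bit strings which agree with `x` on `S`. -/
def agreeProj (x : ι → Fin 2) (S : Finset ι) : Matrix (ι → Fin 2) (ι → Fin 2) ℂ :=
  diagonal fun y => if ∀ j ∈ S, y j = x j then 1 else 0

theorem agreeProj_empty (x : ι → Fin 2) : agreeProj x ∅ = 1 := by
  simp [agreeProj]

theorem agreeProj_univ (x : ι → Fin 2) : agreeProj x Finset.univ = Matrix.single x x 1 := by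
  rw [← diagonal_single, agreeProj]
  congr 1
  ext y
  simp [Pi.single_apply, funext_iff]

/-- Half of `1 ± siteZ k`, with the sign of the bit `x k`, projects onto the strings that agree with
`x` at `k`. -/
theorem agreeProj_insert (x : ι → Fin 2) (S : Finset ι) (k : ι) :
    agreeProj x S + bitSign (x k) • (siteZ k * agreeProj x S)
      = (2 : ℂ) • agreeProj x (insert k S) := by
  rw [agreeProj, siteZ, diagonal_mul_diagonal, ← diagonal_smul, diagonal_add, agreeProj,
    ← diagonal_smul]
  congr 1
  ext y
  have h := one_add_bitSign_mul_bitSign (x k) (y k)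
  simp only [Pi.smul_apply, smul_eq_mul, Finset.forall_mem_insert]
  by_cases h1 : y k = x k
  · simp only [h1, if_true, true_and] at h ⊢
    split_ifs
    · linear_combination h
    · simp
  · simp only [h1, if_false, false_and] at h ⊢
    split_ifs
    · linear_combination h
    · simp

theorem siteZ_mul_agreeProj (x : ι → Fin 2) (S : Finset ι) (k : ι) :
    agreeProj x S * siteZ k = siteZ k * agreeProj x S := by
  simp [agreeProj, siteZ]

theorem siteX_mul_single (k : ι) (x : ι → Fin 2) :
    siteX k * Matrix.single x x 1 = Matrix.single (flipBit k x) x 1 := by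
  ext u v
  have h : x = flipBit k u ↔ flipBit k x = u := by rw [eq_flipBit_iff, eq_comm]
  simp only [siteX_mul_apply, single_apply, h]

variable {M : Submodule ℂ (Matrix (ι → Fin 2) (ι → Fin 2) ℂ)}

namespace CommutatorClosed

-- Commuting with `Z_k (1 ± Z_j)` interchanges `X_k D` and `X_k Z_k D`, up to a scalar, while adding
-- `j` to the sites fixed by the projection `D`. Both families are therefore carried through the
-- induction.
set_option linter.unusedSimpArgs false in
theorem siteX_mul_agreeProj_mem (hM : CommutatorClosed M) (hX : ∀ k, siteX k ∈ M)
    (hY : ∀ k, siteX k * siteZ k ∈ M) (hZ : ∀ k, siteZ k ∈ M)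
    (hZZ : ∀ j k, j ≠ k → siteZ j * siteZ k ∈ M) (x : ι → Fin 2) (k : ι) (S : Finset ι)
    (hS : k ∉ S) :
    siteX k * agreeProj x S ∈ M ∧ siteX k * siteZ k * agreeProj x S ∈ M := by
  induction S using Finset.induction_on with
  | empty => simp [agreeProj_empty, hX, hY]
  | insert j S hj ih =>
    have hkj : k ≠ j := fun h => hS (h ▸ Finset.mem_insert_self _ _)
    obtain ⟨ih1, ih2⟩ := ih fun h => hS (Finset.mem_insert_of_mem h)
    have hp : siteZ k + bitSign (x j) • (siteZ k * siteZ j) ∈ M :=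
      M.add_mem (hZ k) (M.smul_mem _ (hZZ k j hkj))
    have hD := agreeProj_insert x S j
    have hzD := siteZ_mul_agreeProj x S k
    have hzD' := siteZ_mul_agreeProj x S j
    set D := agreeProj x S
    set D' := agreeProj x (insert j S)
    obtain ⟨a1, a2, a3⟩ := pauliPair_site k
    obtain ⟨p1, p2, p3, p4⟩ := pauliCommute_site hkj
    set X : Matrix (ι → Fin 2) (ι → Fin 2) ℂ := siteX k
    set Z : Matrix (ι → Fin 2) (ι → Fin 2) ℂ := siteZ k
    set Z' : Matrix (ι → Fin 2) (ι → Fin 2) ℂ := siteZ j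
    have a1' := mul_mul_eq_of_mul_eq a1
    have a2' := mul_mul_eq_of_mul_eq a2
    have a3' := mul_mul_eq_of_mul_eq a3
    have p3' := mul_mul_eq_of_mul_eq p3
    have p4' := mul_mul_eq_of_mul_eq p4
    have d1' := mul_mul_eq_of_mul_eq hzD
    have e1 : (Z + bitSign (x j) • (Z * Z')) * (X * D) - X * D * (Z + bitSign (x j) • (Z * Z'))
        = (-4 : ℂ) • (X * Z * D') := by
      rw [show (-4 : ℂ) • (X * Z * D') = (-2 : ℂ) • (X * Z * ((2 : ℂ) • D')) by
        rw [mul_smul_comm]; module, ← hD]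
      simp only [mul_add, add_mul, mul_neg, neg_mul, neg_neg, mul_one, one_mul, mul_smul_comm,
        smul_mul_assoc, mul_assoc, a1, a2, a3, a1', a2', a3', p3, p4, p3', p4', hzD, hzD', d1']
      module
    have e2 : (Z + bitSign (x j) • (Z * Z')) * (X * Z * D)
        - X * Z * D * (Z + bitSign (x j) • (Z * Z')) = (-4 : ℂ) • (X * D') := by
      rw [show (-4 : ℂ) • (X * D') = (-2 : ℂ) • (X * ((2 : ℂ) • D')) by
        rw [mul_smul_comm]; module, ← hD]
      simp only [mul_add, add_mul, mul_neg, neg_mul, neg_neg, mul_one, one_mul, mul_smul_comm,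
        smul_mul_assoc, mul_assoc, a1, a2, a3, a1', a2', a3', p3, p4, p3', p4', hzD, hzD', d1']
      module
    exact ⟨mem_of_smul_mem (by norm_num) (e2 ▸ hM hp ih2),
      mem_of_smul_mem (by norm_num) (e1 ▸ hM hp ih1)⟩

/-- With every site but `k` fixed, the projection onto `x` is a combination of `D` and `Z_k D`, so
its product with `X_k` is covered. -/
theorem single_flipBit_mem (hM : CommutatorClosed M) (hX : ∀ k, siteX k ∈ M)
    (hY : ∀ k, siteX k * siteZ k ∈ M) (hZ : ∀ k, siteZ k ∈ M)
    (hZZ : ∀ j k, j ≠ k → siteZ j * siteZ k ∈ M) (x : ι → Fin 2) (k : ι) :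
    Matrix.single (flipBit k x) x (1 : ℂ) ∈ M := by
  obtain ⟨h1, h2⟩ := hM.siteX_mul_agreeProj_mem hX hY hZ hZZ x k (Finset.univ.erase k)
    (Finset.notMem_erase _ _)
  have h := agreeProj_insert x (Finset.univ.erase k) k
  rw [Finset.insert_erase (Finset.mem_univ k), agreeProj_univ] at h
  refine mem_of_smul_mem two_ne_zero ?_
  rw [← siteX_mul_single, ← mul_smul_comm, ← h, mul_add, mul_smul_comm, ← mul_assoc]
  exact M.add_mem h1 (M.smul_mem _ h2)

/-- Bits are corrected one at a time: for `x ≠ y`, the commutator of `E_{xw}` and `E_{wy}` is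
`E_{xy}`. The induction runs over a set containing all sites where `x` and `y` differ. -/
theorem single_mem (hM : CommutatorClosed M)
    (hflip : ∀ x k, Matrix.single (flipBit k x) x (1 : ℂ) ∈ M) (x y : ι → Fin 2) (hxy : x ≠ y) :
    Matrix.single x y (1 : ℂ) ∈ M := by
  have key (T : Finset ι) : ∀ x y : ι → Fin 2, (∀ j ∉ T, x j = y j) → x ≠ y →
      Matrix.single x y (1 : ℂ) ∈ M := by
    induction T using Finset.induction_on with
    | empty => exact fun x y h hne => absurd (funext fun j => h j (Finset.notMem_empty j)) hne
    | insert k T hk ih =>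
      intro x y h hne
      by_cases hxk : x k = y k
      · refine ih x y (fun j hj => ?_) hne
        by_cases hjk : j = k
        · rw [hjk, hxk]
        · exact h j (by simp [hjk, hj])
      have hf : Matrix.single x (flipBit k x) (1 : ℂ) ∈ M := by
        have := hflip (flipBit k x) k
        rwa [flipBit_flipBit] at this
      by_cases hw : flipBit k x = y
      · rwa [← hw]
      have hwy : Matrix.single (flipBit k x) y (1 : ℂ) ∈ M := by
        refine ih _ y (fun j hj => ?_) hw
        by_cases hjk : j = k
        · rw [hjk, flipBit_self]
          generalize x k = p at hxk
          generalize y k = q at hxk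
          fin_cases p <;> fin_cases q <;> simp_all
        · rw [flipBit_of_ne hjk]
          exact h j (by simp [hjk, hj])
      have h' := hM hf hwy
      rwa [single_mul_single_same, single_mul_single_of_ne _ _ _ _ (Ne.symm hne), sub_zero,
        one_mul] at h'
  exact key Finset.univ x y (fun j hj => absurd (Finset.mem_univ j) hj) hxy

end CommutatorClosed

/-- A space of matrices which is closed under commutators and contains all off-diagonal matrix
units contains all matrices of trace zero. -/
theorem CommutatorClosed.mem_of_trace_eq_zero {n : Type*} [Fintype n] [DecidableEq n] [Nonempty n]
    {M : Submodule ℂ (Matrix n n ℂ)} (hM : CommutatorClosed M)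
    (h : ∀ x y : n, x ≠ y → Matrix.single x y (1 : ℂ) ∈ M) {A : Matrix n n ℂ}
    (hA : A.trace = 0) : A ∈ M := by
  obtain ⟨o⟩ := ‹Nonempty n›
  have hd (x : n) : Matrix.single x x (1 : ℂ) - Matrix.single o o 1 ∈ M := by
    rcases eq_or_ne x o with rfl | hx
    · simp
    · have := hM (h x o hx) (h o x hx.symm)
      rwa [single_mul_single_same, single_mul_single_same, one_mul] at this
  -- Each diagonal entry is compensated at the base index `o`; after summation the compensation is
  -- the trace.
  have hs (x y : n) : Matrix.single x y (A x y) - (if x = y then A x x else 0) •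
      Matrix.single o o (1 : ℂ) ∈ M := by
    rcases eq_or_ne x y with rfl | hxy
    · have := M.smul_mem (A x x) (hd x)
      rw [smul_sub, smul_single, smul_eq_mul, mul_one] at this
      simpa using this
    · have := M.smul_mem (A x y) (h x y hxy)
      rw [smul_single, smul_eq_mul, mul_one] at this
      simpa [hxy] using this
  have hsum := M.sum_mem fun x (_ : x ∈ Finset.univ) => M.sum_mem fun y (_ : y ∈ Finset.univ) =>
    hs x y
  simp only [Finset.sum_sub_distrib, ← Finset.sum_smul, Finset.sum_ite_eq, Finset.mem_univ,
    if_true] at hsum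
  have ht : ∑ x, A x x = 0 := hA
  rw [ht, zero_smul, sub_zero, ← matrix_eq_sum_single] at hsum
  exact hsum

end MatrixUnits

/-! ### Unitary matrices as exponentials -/

section UnitaryExponential

open Matrix
open scoped Matrix.Norms.L2Operator

variable {n : Type*} [Fintype n] [DecidableEq n]

theorem exp_unitary_conj_diagonal (V : unitaryGroup n ℂ) (d : n → ℂ) :
    NormedSpace.exp ((V : Matrix n n ℂ) * diagonal d * star (V : Matrix n n ℂ))
      = (V : Matrix n n ℂ) * diagonal (fun i => Complex.exp (d i)) * star (V : Matrix n n ℂ) := by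
  have h1 : (V : Matrix n n ℂ) * star (V : Matrix n n ℂ) = 1 := Unitary.coe_mul_star_self V
  have h2 : star (V : Matrix n n ℂ) * (V : Matrix n n ℂ) = 1 := Unitary.coe_star_mul_self V
  have h := Matrix.exp_units_conj (⟨V, star V, h1, h2⟩ : (Matrix n n ℂ)ˣ) (diagonal d)
  simp only [Units.val_mk, Units.inv_mk] at h
  refine h.trans ?_
  rw [Matrix.exp_diagonal]
  congr 3
  ext i
  rw [Pi.coe_exp, Complex.exp_eq_exp_ℂ]

theorem Matrix.IsHermitian.exists_eq_conj_diagonal {A : Matrix n n ℂ} (hA : A.IsHermitian) :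
    ∃ (V : unitaryGroup n ℂ) (d : n → ℝ),
      A = (V : Matrix n n ℂ) * diagonal (fun i => (d i : ℂ)) * star (V : Matrix n n ℂ) :=
  ⟨hA.eigenvectorUnitary, hA.eigenvalues, by
    conv_lhs => rw [hA.spectral_theorem, Unitary.conjStarAlgAut_apply]
    rfl⟩

theorem smul_conj_diagonal (c : ℂ) (V : Matrix n n ℂ) (d : n → ℂ) :
    c • (V * diagonal d * star V) = V * diagonal (fun i => c * d i) * star V := by
  rw [← smul_mul_assoc, ← mul_smul_comm, ← diagonal_smul]
  rfl

theorem trace_unitary_conj (V : unitaryGroup n ℂ) (A : Matrix n n ℂ) :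
    ((V : Matrix n n ℂ) * A * star (V : Matrix n n ℂ)).trace = A.trace := by
  rw [trace_mul_comm, ← mul_assoc, Unitary.coe_star_mul_self, one_mul]

theorem det_unitary_conj (V : unitaryGroup n ℂ) (A : Matrix n n ℂ) :
    ((V : Matrix n n ℂ) * A * star (V : Matrix n n ℂ)).det = A.det := by
  rw [det_mul_comm, ← mul_assoc, Unitary.coe_star_mul_self, one_mul]

theorem Matrix.IsHermitian.det_exp_I_smul {A : Matrix n n ℂ} (hA : A.IsHermitian) :
    (NormedSpace.exp (Complex.I • A)).det = Complex.exp (Complex.I * A.trace) := by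
  obtain ⟨V, d, rfl⟩ := hA.exists_eq_conj_diagonal
  rw [smul_conj_diagonal, exp_unitary_conj_diagonal, det_unitary_conj, trace_unitary_conj,
    det_diagonal, trace_diagonal, Finset.mul_sum, Complex.exp_sum]

theorem Matrix.IsHermitian.exp_I_smul_mem_unitaryGroup {A : Matrix n n ℂ} (hA : A.IsHermitian) :
    NormedSpace.exp (Complex.I • A) ∈ unitaryGroup n ℂ := by
  rw [mem_unitaryGroup_iff, star_eq_conjTranspose, ← exp_conjTranspose, conjTranspose_smul, hA.eq,
    ← exp_add_of_commute _ _ (((Commute.refl A).smul_left _).smul_right _), ← add_smul]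
  simp [NormedSpace.exp_zero]

theorem Matrix.IsHermitian.exp_I_smul_mem_specialUnitaryGroup {A : Matrix n n ℂ}
    (hA : A.IsHermitian) (ht : A.trace = 0) :
    NormedSpace.exp (Complex.I • A) ∈ specialUnitaryGroup n ℂ := by
  rw [mem_specialUnitaryGroup_iff]
  exact ⟨hA.exp_I_smul_mem_unitaryGroup, by rw [hA.det_exp_I_smul, ht, mul_zero, Complex.exp_zero]⟩

/-- Every eigenvalue is `0` or `±2√2`, and `π/√2 · 2√2 = 2π`. -/
theorem Matrix.IsHermitian.exp_eq_one_of_pow_three {A : Matrix n n ℂ} (hA : A.IsHermitian)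
    (h3 : A * A * A = (8 : ℂ) • A) :
    NormedSpace.exp (((Real.pi / √2 : ℝ) : ℂ) • Complex.I • A) = 1 := by
  obtain ⟨V, d, hV⟩ := hA.exists_eq_conj_diagonal
  have h2 : star (V : Matrix n n ℂ) * (V : Matrix n n ℂ) = 1 := Unitary.coe_star_mul_self V
  have hd (i : n) : (d i : ℝ) ^ 3 = 8 * d i := by
    have hD : star (V : Matrix n n ℂ) * A * V = diagonal fun i => (d i : ℂ) := by
      rw [hV, ← mul_assoc, ← mul_assoc, h2, one_mul, mul_assoc, h2, mul_one]
    have e : star (V : Matrix n n ℂ) * (A * A * A) * V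
        = (star (V : Matrix n n ℂ) * A * V) * (star (V : Matrix n n ℂ) * A * V)
          * (star (V : Matrix n n ℂ) * A * V) := by
      have h1 : (V : Matrix n n ℂ) * star (V : Matrix n n ℂ) = 1 := Unitary.coe_mul_star_self V
      simp only [mul_assoc, mul_mul_eq_of_mul_eq h1, one_mul]
    rw [h3, mul_smul_comm, smul_mul_assoc, hD, diagonal_mul_diagonal, diagonal_mul_diagonal,
      ← diagonal_smul] at e
    have := congrFun (diagonal_injective e) i
    simp only [Pi.smul_apply, smul_eq_mul] at this
    have h' : (d i : ℂ) ^ 3 = 8 * d i := by rw [this]; ring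
    exact_mod_cast h'
  have hexp (i : n) : Complex.exp (((Real.pi / √2 : ℝ) : ℂ) * (Complex.I * d i)) = 1 := by
    have h0 : d i * ((d i - 2 * √2) * (d i + 2 * √2)) = 0 := by
      have := Real.sq_sqrt (zero_le_two (α := ℝ))
      linear_combination hd i - 4 * d i * this
    have hs : (√2 : ℝ) ≠ 0 := by positivity
    rw [Complex.exp_eq_one_iff]
    rcases mul_eq_zero.1 h0 with h | h
    · exact ⟨0, by rw [h]; simp⟩
    rcases mul_eq_zero.1 h with h | h
    · refine ⟨1, ?_⟩
      have e : Real.pi / √2 * d i = 2 * Real.pi := by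
        rw [sub_eq_zero.1 h]
        field_simp
      have e' : (((Real.pi / √2 : ℝ) : ℂ)) * d i = 2 * Real.pi := by exact_mod_cast e
      push_cast at e' ⊢
      linear_combination Complex.I * e'
    · refine ⟨-1, ?_⟩
      have e : Real.pi / √2 * d i = -(2 * Real.pi) := by
        rw [eq_neg_of_add_eq_zero_left h]
        field_simp
      have e' : (((Real.pi / √2 : ℝ) : ℂ)) * d i = -(2 * Real.pi) := by exact_mod_cast e
      push_cast at e' ⊢
      linear_combination Complex.I * e'
  rw [hV, smul_conj_diagonal, smul_conj_diagonal, exp_unitary_conj_diagonal]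
  simp only [hexp, diagonal_one, mul_one]
  exact Unitary.coe_mul_star_self V

theorem exists_isHermitian_exp_eq {U : Matrix n n ℂ} (hU : U ∈ unitaryGroup n ℂ) :
    ∃ A : Matrix n n ℂ, A.IsHermitian ∧ NormedSpace.exp (Complex.I • A) = U := by
  have hn : IsStarNormal U := ⟨by
    rw [commute_iff_eq, (mem_unitaryGroup_iff.1 hU : U * star U = 1),
      (mem_unitaryGroup_iff'.1 hU : star U * U = 1)]⟩
  have hfin : (spectrum ℂ U).Finite := U.finite_spectrum
  have hcont (f : ℂ → ℂ) : ContinuousOn f (spectrum ℂ U) := hfin.continuousOn f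
  -- The jump of `arg` does no harm since the spectrum is finite; it lies on the unit circle, where
  -- `exp (i arg z) = z`.
  refine ⟨cfc (fun z : ℂ => (Complex.arg z : ℂ)) U, ?_, ?_⟩
  · have h : star (cfc (fun z : ℂ => (Complex.arg z : ℂ)) U)
        = cfc (fun z : ℂ => (Complex.arg z : ℂ)) U := by
      rw [← cfc_star]
      simp
    exact h
  · rw [← cfc_const_mul Complex.I _ U (hcont _), ← CFC.complex_exp_eq_normedSpace_exp,
      ← cfc_comp' Complex.exp _ U (by fun_prop) (hcont _)]
    conv_rhs => rw [← cfc_id ℂ U]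
    refine cfc_congr fun z hz => ?_
    have hz1 : ‖z‖ = 1 := spectrum.norm_eq_one_of_unitary hU hz
    have := Complex.norm_mul_exp_arg_mul_I z
    rw [hz1, Complex.ofReal_one, one_mul] at this
    rw [mul_comm, this, id]

theorem exists_isHermitian_trace_eq_zero_exp_eq [Nonempty n] {U : Matrix n n ℂ}
    (hU : U ∈ specialUnitaryGroup n ℂ) :
    ∃ A : Matrix n n ℂ, A.IsHermitian ∧ A.trace = 0 ∧ NormedSpace.exp (Complex.I • A) = U := by
  obtain ⟨hU, hdet⟩ := mem_specialUnitaryGroup_iff.1 hU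
  obtain ⟨B, hB, rfl⟩ := exists_isHermitian_exp_eq hU
  rw [hB.det_exp_I_smul, Complex.exp_eq_one_iff] at hdet
  obtain ⟨m, hm⟩ := hdet
  obtain ⟨V, d, rfl⟩ := hB.exists_eq_conj_diagonal
  obtain ⟨o⟩ := ‹Nonempty n›
  have htr : (∑ i, (d i : ℂ)) = m * (2 * Real.pi) := by
    rw [trace_unitary_conj, trace_diagonal] at hm
    apply mul_left_cancel₀ Complex.I_ne_zero
    rw [hm]
    ring
  -- Determinant 1 forces the trace to be `2πm`; moving one eigenvalue by `2πm` kills the trace and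
  -- leaves the exponential unchanged.
  let d' : n → ℝ := d - Pi.single o (m * (2 * Real.pi))
  refine ⟨(V : Matrix n n ℂ) * diagonal (fun i => (d' i : ℂ)) * star (V : Matrix n n ℂ), ?_, ?_, ?_⟩
  · refine isHermitian_mul_mul_conjTranspose _ (isHermitian_diagonal_of_self_adjoint _ ?_)
    ext i
    simp
  · rw [trace_unitary_conj, trace_diagonal]
    have : ∑ i, d' i = 0 := by
      have htr' : ∑ i, d i = m * (2 * Real.pi) := by exact_mod_cast htr
      simp [d', Finset.sum_sub_distrib, htr']
    exact_mod_cast this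
  · rw [smul_conj_diagonal, exp_unitary_conj_diagonal, smul_conj_diagonal,
      exp_unitary_conj_diagonal]
    congr 3
    ext i
    rcases eq_or_ne i o with rfl | hi
    · rw [Complex.exp_eq_exp_iff_exists_int]
      refine ⟨-m, ?_⟩
      simp [d']
      ring
    · simp [d', hi]

end UnitaryExponential

/-! ### Closed monoids of unitary matrices -/

section MatrixTangent

open Matrix Filter Topology
open scoped Matrix.Norms.L2Operator

variable {n : Type*} [Fintype n] [DecidableEq n]

theorem norm_le_one_of_mem_unitaryGroup {U : Matrix n n ℂ} (hU : U ∈ unitaryGroup n ℂ) :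
    ‖U‖ ≤ 1 := by
  cases subsingleton_or_nontrivial (Matrix n n ℂ)
  · rw [Subsingleton.elim U 0, norm_zero]
    exact zero_le_one
  · exact (CStarRing.norm_of_mem_unitary hU).le

theorem star_eq_neg_of_exp_mem_unitaryGroup {X : Matrix n n ℂ}
    (h : ∀ t : ℝ, NormedSpace.exp (t • X) ∈ unitaryGroup n ℂ) : star X = -X := by
  have hd := (hasDerivAt_exp_smul_const (𝕂 := ℝ) X 0).mul
    (hasDerivAt_exp_smul_const (𝕂 := ℝ) (star X) 0)
  simp only [zero_smul, NormedSpace.exp_zero, one_mul, mul_one] at hd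
  have h1 (t : ℝ) : NormedSpace.exp (t • X) * NormedSpace.exp (t • star X) = 1 := by
    rw [← mem_unitaryGroup_iff.1 (h t), star_eq_conjTranspose (NormedSpace.exp _),
      ← exp_conjTranspose, conjTranspose_smul, star_trivial t, star_eq_conjTranspose]
  have hc : HasDerivAt (fun _ : ℝ => (1 : Matrix n n ℂ)) (X + star X) 0 :=
    hd.congr_of_eventuallyEq (Eventually.of_forall fun t => (h1 t).symm)
  exact eq_neg_of_add_eq_zero_right (hc.unique (hasDerivAt_const _ _))

/-- A closed monoid of unitary matrices contains the special unitary group as soon as its complex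
tangent algebra contains all off-diagonal matrix units. -/
theorem specialUnitaryGroup_le_of_single_mem [Nonempty n] {K : Submonoid (Matrix n n ℂ)}
    (hK : IsClosed (K : Set (Matrix n n ℂ))) (hKU : K ≤ unitaryGroup n ℂ)
    {C : ℝ} (hC : ∀ U ∈ K, ‖U‖ ≤ C)
    (h : ∀ x y : n, x ≠ y → Matrix.single x y (1 : ℂ) ∈ complexTangentAlgebra K hK hC) :
    specialUnitaryGroup n ℂ ≤ K := by
  intro U hU
  obtain ⟨A, hA, ht, rfl⟩ := exists_isHermitian_trace_eq_zero_exp_eq hU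
  have hM : CommutatorClosed (complexTangentAlgebra K hK hC) := fun _ h1 _ h2 =>
    commutator_mem_complexTangentAlgebra h1 h2
  have hAM := Submodule.smul_mem _ Complex.I (hM.mem_of_trace_eq_zero h ht)
  obtain ⟨X, hX, Y, hY, hXY⟩ := mem_complexTangentAlgebra.1 hAM
  have hX' : star X = -X := star_eq_neg_of_exp_mem_unitaryGroup fun t => hKU (hX t)
  have hY' : star Y = -Y := star_eq_neg_of_exp_mem_unitaryGroup fun t => hKU (hY t)
  have hs := congrArg star hXY
  rw [star_add, star_smul, star_smul, hX', hY', star_eq_conjTranspose A, hA.eq] at hs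
  have hI : star Complex.I = -Complex.I := Complex.conj_I
  rw [hI, neg_smul, neg_smul, hXY] at hs
  -- In `iA = X + iY` the matrices `iA`, `X`, `Y` are skew-Hermitian while `iY` is Hermitian, so
  -- `iY` vanishes and `iA = X` is itself tangent.
  have hY0 : Y = 0 := by
    have : (2 * Complex.I) • Y = 0 := by
      rw [mul_smul, two_smul]
      have := congrArg (fun B => B + (X + Complex.I • Y)) hs
      simp only [neg_add_cancel] at this
      rw [this]
      module
    exact (smul_eq_zero.1 this).resolve_left (by simp)
  rw [hY0, smul_zero, add_zero] at hXY
  rw [hXY]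
  simpa using hX 1

end MatrixTangent

/-! ### Density of the group generated by the gates -/

section Density

open Matrix

variable {l : ℕ}

theorem isHermitian_actOn_hamiltonianH {a b : Fin l} (hab : a ≠ b) :
    (actOn hamiltonianH a b).IsHermitian := by
  rw [actOn_hamiltonianH hab]
  refine (((isHermitian_siteX a).add (isHermitian_siteZ b)).add ?_).add ?_
  · rw [IsHermitian, conjTranspose_mul, (isHermitian_siteX a).eq, (isHermitian_siteX b).eq,
      (pauliCommute_site hab).xx]
  · rw [IsHermitian, conjTranspose_mul, (isHermitian_siteZ a).eq, (isHermitian_siteZ b).eq,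
      (pauliCommute_site hab).zz]

theorem trace_eq_zero_of_anticommute {n : Type*} [Fintype n] [DecidableEq n]
    {S A : Matrix n n ℂ} (hS : S * S = 1) (hA : S * A = -(A * S)) : A.trace = 0 := by
  have h : A.trace = -A.trace := by
    calc A.trace = (S * S * A).trace := by rw [hS, one_mul]
      _ = (S * A * S).trace := by rw [mul_assoc, trace_mul_comm]
      _ = -A.trace := by rw [hA, neg_mul, mul_assoc, hS, mul_one, trace_neg]
  exact self_eq_neg.1 h

/-- Each of the four terms anticommutes with some one-site Pauli operator. -/
theorem trace_actOn_hamiltonianH {a b : Fin l} (hab : a ≠ b) :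
    (actOn hamiltonianH a b).trace = 0 := by
  obtain ⟨a1, a2, a3⟩ := pauliPair_site a
  obtain ⟨b1, b2, b3⟩ := pauliPair_site b
  obtain ⟨c1, c2, c3, c4⟩ := pauliCommute_site hab
  rw [actOn_hamiltonianH hab, trace_add, trace_add, trace_add,
    trace_eq_zero_of_anticommute a2 a3, trace_eq_zero_of_anticommute b1 (by rw [b3, neg_neg]),
    trace_eq_zero_of_anticommute a2 (A := siteX a * siteX b) (by
      rw [← mul_assoc, a3, neg_mul, mul_assoc, ← c2, mul_assoc]),
    trace_eq_zero_of_anticommute a1 (A := siteZ a * siteZ b) (by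
      rw [← mul_assoc, mul_assoc (siteZ a), c3, ← mul_assoc, a3, neg_mul, neg_neg])]
  simp

set_option linter.unusedSimpArgs false in
theorem actOn_hamiltonianH_pow_three {a b : Fin l} (hab : a ≠ b) :
    actOn hamiltonianH a b * actOn hamiltonianH a b * actOn hamiltonianH a b
      = (8 : ℂ) • actOn hamiltonianH a b := by
  obtain ⟨a1, a2, a3⟩ := pauliPair_site a
  obtain ⟨b1, b2, b3⟩ := pauliPair_site b
  obtain ⟨p1, p2, p3, p4⟩ := pauliCommute_site hab
  have a1' := mul_mul_eq_of_mul_eq a1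
  have a2' := mul_mul_eq_of_mul_eq a2
  have a3' := mul_mul_eq_of_mul_eq a3
  have b1' := mul_mul_eq_of_mul_eq b1
  have b2' := mul_mul_eq_of_mul_eq b2
  have b3' := mul_mul_eq_of_mul_eq b3
  have p1' := mul_mul_eq_of_mul_eq p1
  have p2' := mul_mul_eq_of_mul_eq p2
  have p3' := mul_mul_eq_of_mul_eq p3
  have p4' := mul_mul_eq_of_mul_eq p4
  rw [actOn_hamiltonianH hab]
  simp only [mul_add, add_mul, mul_neg, neg_mul, neg_neg, mul_one, one_mul, mul_assoc,
    a1, a2, a3, b1, b2, b3, a1', a2', a3', b1', b2', b3', p1, p2, p3, p4, p1', p2', p3', p4']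
  module

theorem ringGate_mem_specialUnitaryGroup {k : Fin l} (hk : k ≠ cyclicSucc k) :
    ringGate l k ∈ specialUnitaryGroup (Fin l → Fin 2) ℂ := by
  rw [ringGate_eq_exp hk]
  exact (isHermitian_actOn_hamiltonianH hk).exp_I_smul_mem_specialUnitaryGroup
    (trace_actOn_hamiltonianH hk)

/-- If `A³ = 8 A`, then the closure of a group of special unitary matrices which contains
`exp (i A)` contains the whole one-parameter group of `i A`. -/
theorem exp_smul_mem_closure {n : Type*} [Fintype n] [DecidableEq n]
    (S : Subgroup (specialUnitaryGroup n ℂ)) {A : Matrix n n ℂ} (hA : A.IsHermitian)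
    (h3 : A * A * A = (8 : ℂ) • A)
    (h : ∃ U ∈ S, (U : Matrix n n ℂ) = NormedSpace.exp (Complex.I • A)) (t : ℝ) :
    NormedSpace.exp ((t : ℂ) • Complex.I • A) ∈
      closure (Subtype.val '' (S : Set (specialUnitaryGroup n ℂ))) := by
  -- The times `s` at which `exp (isA)` lies in `S` include the period `π/√2` and `1`, which
  -- generate a dense subgroup of the reals.
  have hdense : Dense (AddSubgroup.closure {Real.pi / √2, 1} : Set ℝ) := by
    rw [dense_addSubgroupClosure_pair_iff, div_one]
    exact irrational_pi_div_sqrt_two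
  have hsub (s : ℝ) (hs : s ∈ AddSubgroup.closure {Real.pi / √2, 1}) :
      ∃ U ∈ S, (U : Matrix n n ℂ) = NormedSpace.exp ((s : ℂ) • Complex.I • A) := by
    induction hs using AddSubgroup.closure_induction with
    | mem x hx =>
      rcases hx with rfl | rfl
      · exact ⟨1, S.one_mem, (hA.exp_eq_one_of_pow_three h3).symm⟩
      · simpa using h
    | zero => exact ⟨1, S.one_mem, by simp [NormedSpace.exp_zero]⟩
    | add x y _ _ hx hy =>
      obtain ⟨U, hU, hU'⟩ := hx
      obtain ⟨V, hV, hV'⟩ := hy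
      refine ⟨U * V, S.mul_mem hU hV, ?_⟩
      rw [Complex.ofReal_add, add_smul, exp_add_of_commute _ _
        (((Commute.refl _).smul_left _).smul_right _), ← hU', ← hV']
      rfl
    | neg x _ hx =>
      obtain ⟨U, hU, hU'⟩ := hx
      refine ⟨U⁻¹, S.inv_mem hU, ?_⟩
      change star (U : Matrix n n ℂ) = _
      rw [hU', star_eq_conjTranspose, ← exp_conjTranspose, conjTranspose_smul, conjTranspose_smul,
        hA.eq]
      simp
  have hcont : Continuous fun s : ℝ => NormedSpace.exp ((s : ℂ) • Complex.I • A) := by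
    open scoped Matrix.Norms.L2Operator in
    let _ : NormedAlgebra ℚ (Matrix n n ℂ) := NormedAlgebra.restrictScalars ℚ ℂ _
    exact (NormedSpace.exp_continuous (𝔸 := Matrix n n ℂ)).comp
      (Complex.continuous_ofReal.smul continuous_const)
  refine map_mem_closure (f := fun s : ℝ => NormedSpace.exp ((s : ℂ) • Complex.I • A)) hcont (hdense t) fun s hs => ?_
  obtain ⟨U, hU, hU'⟩ := hsub s hs
  exact ⟨U, hU, hU'⟩

open scoped Matrix.Norms.L2Operator in
theorem dense_of_ringGate_mem (hl : 3 ≤ l) (S : Subgroup (specialUnitaryGroup (Fin l → Fin 2) ℂ))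
    (hS : ∀ k : Fin l, ∃ U ∈ S, (U : Matrix (Fin l → Fin 2) (Fin l → Fin 2) ℂ) = ringGate l k) :
    Dense (S : Set (specialUnitaryGroup (Fin l → Fin 2) ℂ)) := by
  let K : Submonoid (Matrix (Fin l → Fin 2) (Fin l → Fin 2) ℂ) :=
    (S.toSubmonoid.map (specialUnitaryGroup (Fin l → Fin 2) ℂ).subtype).topologicalClosure
  have hK : IsClosed (K : Set (Matrix (Fin l → Fin 2) (Fin l → Fin 2) ℂ)) := isClosed_closure
  have hKU : K ≤ unitaryGroup (Fin l → Fin 2) ℂ := by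
    refine Submonoid.topologicalClosure_minimal _ ?_ (isClosed_unitary)
    rintro _ ⟨U, _, rfl⟩
    exact specialUnitaryGroup_le_unitaryGroup U.2
  have hC : ∀ U ∈ K, ‖U‖ ≤ 1 := fun U hU => norm_le_one_of_mem_unitaryGroup (hKU hU)
  have hM : CommutatorClosed (complexTangentAlgebra K hK hC) := fun _ h1 _ h2 =>
    commutator_mem_complexTangentAlgebra h1 h2
  have hH (k : Fin l) : actOn hamiltonianH k (cyclicSucc k) ∈ complexTangentAlgebra K hK hC := by
    have hk := cyclicSucc_ne hl k
    have hI : Complex.I • actOn hamiltonianH k (cyclicSucc k) ∈ tangentSpace K hK hC := by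
      rw [mem_tangentSpace_iff_complex]
      intro t
      refine exp_smul_mem_closure S (isHermitian_actOn_hamiltonianH hk)
        (actOn_hamiltonianH_pow_three hk) ?_ t
      rw [← ringGate_eq_exp hk]
      exact hS k
    refine mem_complexTangentAlgebra.2 ⟨0, zero_mem _, -(Complex.I • _), neg_mem hI, ?_⟩
    rw [smul_neg, smul_smul, Complex.I_mul_I, neg_one_smul, neg_neg, zero_add]
  have hle := specialUnitaryGroup_le_of_single_mem hK hKU hC (hM.single_mem
    (hM.single_flipBit_mem (hM.siteX_mem hl hH) (hM.siteY_mem hl hH) (hM.siteZ_mem hl hH)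
      fun _ _ h => hM.siteZ_mul_siteZ_mem hl hH h))
  intro U
  rw [closure_subtype]
  exact hle U.2

end Density

theorem mainTheorem2 (l : ℕ) (hl : 3 ≤ l) :
    (∀ k : Fin l, ringGate l k ∈ Matrix.specialUnitaryGroup (Fin l → Fin 2) ℂ) ∧
    Dense ((Subgroup.closure {U : Matrix.specialUnitaryGroup (Fin l → Fin 2) ℂ |
        ∃ k : Fin l, (U : Matrix (Fin l → Fin 2) (Fin l → Fin 2) ℂ) = ringGate l k} :
      Subgroup (Matrix.specialUnitaryGroup (Fin l → Fin 2) ℂ)) :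
        Set (Matrix.specialUnitaryGroup (Fin l → Fin 2) ℂ)) := by
  have h (k : Fin l) := ringGate_mem_specialUnitaryGroup (cyclicSucc_ne hl k)
  exact ⟨h, dense_of_ringGate_mem hl _ fun k =>
    ⟨⟨_, h k⟩, Subgroup.subset_closure ⟨k, rfl⟩, rfl⟩⟩
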